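/- Let $\mathcal X$ be a finite alphabet, $p_X$ a probability mass function on $\mathcal X$ with entropy $H(X)=-\sum_{x}p_X(x)\log_2 p_X(x)$ (with $0\log_2 0=0$), let $q\in(0,1)$ and $r_{\mathrm{ch}}>0$. At each time step $t=1,2,\dots$ a new source symbol arrives with probability $q$, independently over time; let $A_n$ be the arrival time of the $n$-th symbol and $A_0=0$. The symbols $X_1,X_2,\dots$ are i.i.d. with law $p_X$ and independent of the arrivals. A variable-to-fixed code consists of an output length $\ell\ge 1$, a prefix-free set $\mathcal I\subseteq\mathcal X^*$ of nonempty words such that every infinite sequence over $\mathcal X$ has a prefix in $\mathcal I$, and an injective map $\mathcal I\to\{0,1\}^\ell$. The code cuts the symbol stream uniquely into consecutive blocks that are words of $\mathcal I$; let $N_i$ be the number of symbols in the first $i$ blocks ($N_0=0$). The codeword of block $i$ enters a first-in first-out channel of rate $r_{\mathrm{ch}}$ bits per unit of time at time $A_{N_i}$, so that block $i$ is decoded at time $R_i=\max(A_{N_i},R_{i-1})+\ell/r_{\mathrm{ch}}$, where $R_0=0$. The delay of the $n$-th symbol is $\Delta_n=R_i-A_n$, where $i$ is the block containing it (i.e.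 $N_{i-1}<n\le N_i$), and the peak age of information (AoI) of block $i$ is $\Gamma_i=R_i-A_{N_{i-1}}$. The mean delay and the mean peak AoI are the almost sure limits $$\bar\Delta=\lim_{n\to\infty}\frac1n\sum_{k=1}^n\Delta_k,\qquad \bar\Gamma=\lim_{i\to\infty}\frac1i\sum_{k=1}^i\Gamma_k .$$ Then each of the following holds if and only if $$H(X)<\frac{r_{\mathrm{ch}}}{q}:$$ 1. there is a variable-to-fixed code for which the mean delay $\bar\Delta$ and the mean peak AoI $\bar\Gamma$ both exist as finite (deterministic) real numbers; 2. there is a variable-to-fixed code for which the averages $\frac1n\sum_{k=1}^n\Delta_k$, $n\ge1$, are almost surely bounded; 3. there is a variable-to-fixed code for which the averages $\frac1i\sum_{k=1}^i\Gamma_k$, $i\ge1$, are almost surely bounded. -/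

import Mathlib

open MeasureTheory ProbabilityTheory Filter Topology

namespace RealTimeCoding

noncomputable section

/-- The Shannon entropy, in bits, of a probability mass function on a finite alphabet. -/
def entropy {𝒳 : Type*} [Fintype 𝒳] (p : PMF 𝒳) : ℝ :=
  -∑ x, (p x).toReal * Real.logb 2 (p x).toReal

/-- A memoryless lossless variable-to-fixed binary code with source alphabet `𝒳`: the stream of
source symbols is cut into words of the dictionary `dict`, and each of these words is mapped,
injectively, to a codeword of `len` bits. The dictionary is prefix-free, and every stream of source
symbols starts with a word of it, so every stream is cut in exactly one way. -/
structure V2FCode (𝒳 : Type*) where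
  /-- the output length in bits -/
  len : ℕ
  len_pos : 0 < len
  /-- the set of source words -/
  dict : Set (List 𝒳)
  nil_notMem : [] ∉ dict
  prefix_free : ∀ u ∈ dict, ∀ v ∈ dict, u <+: v → u = v
  complete : ∀ x : ℕ → 𝒳, ∃ n, (List.range n).map x ∈ dict
  /-- the codeword of a source word -/
  enc : List 𝒳 → (Fin len → Bool)
  enc_injOn : Set.InjOn enc dict

/-- The length of the source word with which the stream `x` starts. -/
def V2FCode.blockLen {𝒳 : Type*} (c : V2FCode 𝒳) (x : ℕ → 𝒳) : ℕ :=
  sInf {n | (List.range n).map x ∈ c.dict}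

/-- The number of symbols in the first `i` blocks of the stream `x` (whose symbol number `n ≥ 1` is
`x (n - 1)`); thus block `i ≥ 1` consists of the symbols with numbers `n` such that
`c.blockEnd x (i - 1) < n ≤ c.blockEnd x i`. -/
def V2FCode.blockEnd {𝒳 : Type*} (c : V2FCode 𝒳) (x : ℕ → 𝒳) : ℕ → ℕ
  | 0 => 0
  | i + 1 => c.blockEnd x i + c.blockLen (fun k => x (c.blockEnd x i + k))

/-- The index `i ≥ 1` of the block that contains the symbol with number `n ≥ 1`. -/
def V2FCode.blockOf {𝒳 : Type*} (c : V2FCode 𝒳) (x : ℕ → 𝒳) (n : ℕ) : ℕ :=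
  sInf {i | n ≤ c.blockEnd x i}

/-- The arrival time of the symbol with number `n ≥ 1`, where `a t` says whether a symbol arrives
at the time step `t + 1`; `arrivalTime a 0 = 0`. (If infinitely many symbols arrive, then
`arrivalTime a (n + 1)` is the first time step after `arrivalTime a n` with an arrival.) -/
def arrivalTime (a : ℕ → Bool) : ℕ → ℕ
  | 0 => 0
  | n + 1 => sInf {t | arrivalTime a n ≤ t ∧ a t = true} + 1

/-- The time at which block `i ≥ 1` is decoded. Its codeword enters the FIFO channel, which emits
`r` bits per unit of time, when the last symbol of the block arrives; its service starts as soon as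
it has entered and the previous codeword has left, and takes `c.len / r` units of time. -/
def decodeTime {𝒳 : Type*} (c : V2FCode 𝒳) (r : ℝ) (x : ℕ → 𝒳) (a : ℕ → Bool) : ℕ → ℝ
  | 0 => 0
  | i + 1 => max (arrivalTime a (c.blockEnd x (i + 1)) : ℝ) (decodeTime c r x a i) + c.len / r

/-- The delay of the symbol with number `n ≥ 1`: decoding time minus arrival time. -/
def delay {𝒳 : Type*} (c : V2FCode 𝒳) (r : ℝ) (x : ℕ → 𝒳) (a : ℕ → Bool) (n : ℕ) : ℝ :=
  decodeTime c r x a (c.blockOf x n) - arrivalTime a n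

/-- The peak age of information of block `i ≥ 1`: the decoding time of block `i` minus the arrival
time of the last symbol of block `i - 1` (time `0` if `i = 1`). -/
def peakAoI {𝒳 : Type*} (c : V2FCode 𝒳) (r : ℝ) (x : ℕ → 𝒳) (a : ℕ → Bool) (i : ℕ) : ℝ :=
  decodeTime c r x a i - arrivalTime a (c.blockEnd x (i - 1))

/-- The average of the terms `u 1, …, u n`. -/
def runningMean (u : ℕ → ℝ) (n : ℕ) : ℝ :=
  (∑ k ∈ Finset.Icc 1 n, u k) / n

/-- The source: at every time step `t + 1` a symbol arrives (`A t = true`) with probability `q`,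
independently over time; the symbols `X 0, X 1, …` are i.i.d. with probability mass function `p`;
the symbols and the arrivals are independent of each other. -/
structure IsSource {𝒳 Ω : Type*} [MeasurableSpace 𝒳] [MeasurableSpace Ω] (μ : Measure Ω)
    (p : PMF 𝒳) (q : ℝ) (X : ℕ → Ω → 𝒳) (A : ℕ → Ω → Bool) : Prop where
  measurable_symbol : ∀ n, Measurable (X n)
  measurable_arrival : ∀ t, Measurable (A t)
  law_symbol : ∀ n, μ.map (X n) = p.toMeasure
  law_arrival : ∀ t, μ {ω | A t ω = true} = ENNReal.ofReal q
  indep_symbol : iIndepFun X μ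
  indep_arrival : iIndepFun A μ
  indep : IndepFun (fun ω n => X n ω) (fun ω t => A t ω) μ

/-- The mean delay, that is, the almost sure limit of the averages of the delays of the first
`n` symbols, exists and is the real number `d`. -/
def HasMeanDelay {𝒳 Ω : Type*} [MeasurableSpace Ω] (μ : Measure Ω) (X : ℕ → Ω → 𝒳)
    (A : ℕ → Ω → Bool) (c : V2FCode 𝒳) (r d : ℝ) : Prop :=
  ∀ᵐ ω ∂μ, Tendsto (runningMean (delay c r (fun n => X n ω) (fun t => A t ω))) atTop (𝓝 d)

/-- The mean peak age of information, that is, the almost sure limit of the averages of the peak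
ages of the first `i` blocks, exists and is the real number `g`. -/
def HasMeanPeakAoI {𝒳 Ω : Type*} [MeasurableSpace Ω] (μ : Measure Ω) (X : ℕ → Ω → 𝒳)
    (A : ℕ → Ω → Bool) (c : V2FCode 𝒳) (r g : ℝ) : Prop :=
  ∀ᵐ ω ∂μ, Tendsto (runningMean (peakAoI c r (fun n => X n ω) (fun t => A t ω))) atTop (𝓝 g)

/-- Almost surely, the averages of the delays of the first `n` symbols stay bounded in `n`. -/
def BoundedMeanDelay {𝒳 Ω : Type*} [MeasurableSpace Ω] (μ : Measure Ω) (X : ℕ → Ω → 𝒳)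
    (A : ℕ → Ω → Bool) (c : V2FCode 𝒳) (r : ℝ) : Prop :=
  ∀ᵐ ω ∂μ, BddAbove (Set.range (runningMean (delay c r (fun n => X n ω) (fun t => A t ω))))

/-- Almost surely, the averages of the peak ages of information of the first `i` blocks stay
bounded in `i`. -/
def BoundedMeanPeakAoI {𝒳 Ω : Type*} [MeasurableSpace Ω] (μ : Measure Ω) (X : ℕ → Ω → 𝒳)
    (A : ℕ → Ω → Bool) (c : V2FCode 𝒳) (r : ℝ) : Prop :=
  ∀ᵐ ω ∂μ, BddAbove (Set.range (runningMean (peakAoI c r (fun n => X n ω) (fun t => A t ω))))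

end

end RealTimeCoding

open RealTimeCoding

/-! The proof separates a queueing statement from a source coding statement. Let `ℓ` be the output
length of a code and `m` its mean block length.

Queueing. The triples (block length, time between block completions, waiting of the symbols for the
end of their block) are i.i.d. over the blocks, by a strong Markov argument
(`V2FCode.map_blockData_iterate`). The time from the completion of a block to its decoding obeys the
Lindley recursion with constant service time `ℓ / r` (`V2FCode.decodeTime_eq`), and the mean time
between completions is `m / q` by Wald's identity. Peak age is interarrival time plus sojourn time,
and the delays in one block add up to length times sojourn time plus the waiting inside the block.
So everything depends on the averages of the sojourn times. If `ℓ / r < m / q`, these averages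
converge (`exists_ae_tendsto_sum_sojourn_div`): forgetting all but the last few customers lowers the
sojourn time by at most a sum of exponential weights of random walks with negative drift, whose
expectation is the tail of a geometric series; Birkhoff's theorem, proved here for ergodic maps,
handles what remains. If `m / q ≤ ℓ / r`, they tend to infinity
(`ae_tendsto_sum_sojourn_div_atTop`). This includes the critical case, where it is essential that `q
< 1` makes the interarrival times unbounded: a queue with bounded mean sojourn time would be idle a
positive fraction of the time, and its mean would grow.

Coding. Every code has `H m ≤ ℓ`, since the first word has entropy `H m` and at most `2 ^ ℓ` values
(`V2FCode.entropy_mul_meanLen_le`). Conversely, for every `R > 0` with `H < R` some code has `ℓ < R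
m` (`exists_code_len_lt`): parse up to length `k`, but stop once the word becomes too unlikely; by
the equipartition property this rarely happens early. With `R = r / q`, a stable code exists exactly
when `H < r / q`; equality is excluded because stability is strict and the converse bound is not. -/

namespace RealTimeCoding

noncomputable section

/-! ### I.i.d. sequences and ergodicity of the shift -/

/-- The shift by `n` on sequences. -/
def shift {E : Type*} (n : ℕ) (z : ℕ → E) : ℕ → E := fun k => z (n + k)

/-- The law of a sequence of independent variables with law `ν`. -/
abbrev iidLaw {E : Type*} [MeasurableSpace E] (ν : Measure E) [IsProbabilityMeasure ν] :
    Measure (ℕ → E) :=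
  Measure.infinitePi fun _ => ν

/-- The sequence that starts with the first `n` terms of `z.1` and continues with `z.2`. -/
def splice {E : Type*} (n : ℕ) (z : (ℕ → E) × (ℕ → E)) : ℕ → E :=
  fun k => if k < n then z.1 k else z.2 (k - n)

section

variable {E : Type*}

lemma shift_apply (n k : ℕ) (z : ℕ → E) : shift n z k = z (n + k) := rfl

@[simp]
lemma shift_zero (z : ℕ → E) : shift 0 z = z := by
  ext k; simp [shift]

lemma shift_shift (m n : ℕ) (z : ℕ → E) : shift m (shift n z) = shift (n + m) z := by
  ext k; simp [shift, add_assoc]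

lemma iterate_shift_one (n : ℕ) : (shift 1 : (ℕ → E) → ℕ → E)^[n] = shift n := by
  induction n with
  | zero => ext z; simp
  | succ n ih => ext1 z; rw [Function.iterate_succ_apply', ih, shift_shift]

lemma shift_splice (n : ℕ) (z : (ℕ → E) × (ℕ → E)) : shift n (splice n z) = z.2 := by
  ext k; simp [shift, splice]

lemma splice_apply_of_lt {n k : ℕ} (h : k < n) (z : (ℕ → E) × (ℕ → E)) :
    splice n z k = z.1 k := if_pos h

variable [MeasurableSpace E]

@[fun_prop]
lemma measurable_shift (n : ℕ) : Measurable (shift n : (ℕ → E) → ℕ → E) := by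
  unfold shift; fun_prop

lemma measurable_splice (n : ℕ) : Measurable (splice n : (ℕ → E) × (ℕ → E) → ℕ → E) := by
  refine measurable_pi_lambda _ fun k => ?_
  unfold splice
  split_ifs <;> fun_prop

variable (ν : Measure E) [IsProbabilityMeasure ν]

/-- The preimage of a box under `splice n` is a product of two boxes, one for the indices below `n`
and one for the others moved down by `n`. This is the source of all independence of past and future
below. -/
lemma map_splice (n : ℕ) :
    ((iidLaw ν).prod (iidLaw ν)).map (splice n) = iidLaw ν := by
  refine Measure.eq_infinitePi _ fun s t ht => ?_
  rw [Measure.map_apply (measurable_splice n)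
    (MeasurableSet.pi s.countable_toSet fun i _ => ht i)]
  have hset : splice n ⁻¹' (Set.pi s t) =
      (Set.pi ((s.filter (· < n) : Finset ℕ) : Set ℕ) t) ×ˢ
        (Set.pi (((s.filter (n ≤ ·)).image (· - n) : Finset ℕ) : Set ℕ) fun k => t (n + k)) := by
    ext z
    simp only [Set.mem_preimage, Set.mem_pi, Finset.mem_coe, Set.mem_prod, Finset.mem_filter,
      Finset.mem_image, splice]
    constructor
    · refine fun h => ⟨fun i hi => by simpa [hi.2] using h i hi.1, ?_⟩
      rintro _ ⟨i, ⟨hi, hn⟩, rfl⟩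
      have := h i hi
      rw [if_neg (by omega)] at this
      rwa [Nat.add_sub_cancel' hn]
    · rintro ⟨h1, h2⟩ i hi
      by_cases hn : i < n
      · simpa [hn] using h1 i ⟨hi, hn⟩
      · have := h2 (i - n) ⟨i, ⟨hi, by omega⟩, rfl⟩
        rw [Nat.add_sub_cancel' (by omega)] at this
        simpa [hn] using this
  rw [hset, Measure.prod_prod, Measure.infinitePi_pi _ (fun i _ => ht i),
    Measure.infinitePi_pi _ (fun i _ => ht _), Finset.prod_image,
    ← Finset.prod_filter_mul_prod_filter_not s (· < n)]
  · congr 1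
    refine Finset.prod_congr (by ext; simp) fun i hi => ?_
    rw [Nat.add_sub_cancel' (by simp at hi; exact hi.2)]
  · intro i hi j hj hij
    simp at hi hj hij
    omega

lemma measurePreserving_splice (n : ℕ) :
    MeasurePreserving (splice n) ((iidLaw ν).prod (iidLaw ν)) (iidLaw ν) :=
  ⟨measurable_splice n, map_splice ν n⟩

lemma measurePreserving_shift (n : ℕ) :
    MeasurePreserving (shift n) (iidLaw ν) (iidLaw ν) := by
  refine ⟨measurable_shift n, ?_⟩
  conv_lhs => rw [← map_splice ν n]
  rw [Measure.map_map (measurable_shift n) (measurable_splice n)]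
  have : shift n ∘ splice n = (Prod.snd : (ℕ → E) × (ℕ → E) → ℕ → E) := by
    ext1 z; exact shift_splice n z
  rw [this]
  exact measurePreserving_snd.map_eq

/-- The set `C` of sequences is determined by the first `n` terms. -/
def DeterminedBy (n : ℕ) (C : Set (ℕ → E)) : Prop :=
  ∀ z z' : ℕ → E, (∀ k < n, z k = z' k) → z ∈ C → z' ∈ C

/-- Pulled back along `splice n`, the intersection becomes the rectangle `C ×ˢ B`. -/
lemma measure_inter_preimage_shift {n : ℕ} {C B : Set (ℕ → E)} (hC : MeasurableSet C)
    (hdet : DeterminedBy n C) (hB : MeasurableSet B) :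
    iidLaw ν (C ∩ shift n ⁻¹' B) = iidLaw ν C * iidLaw ν B := by
  rw [← (measurePreserving_splice ν n).measure_preimage
    (hC.inter (measurable_shift n hB)).nullMeasurableSet]
  have : splice n ⁻¹' (C ∩ shift n ⁻¹' B) = C ×ˢ B := by
    ext z
    simp only [Set.mem_preimage, Set.mem_inter_iff, Set.mem_prod, shift_splice]
    refine and_congr_left fun _ => ⟨hdet _ _ fun k hk => splice_apply_of_lt hk z,
      hdet _ _ fun k hk => (splice_apply_of_lt hk z).symm⟩
  rw [this, Measure.prod_prod]

/-- The Markov property at a fixed time. Restriction with a scalar replaces conditioning, so that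
null sets `C` need no separate treatment. -/
lemma map_shift_restrict {n : ℕ} {C : Set (ℕ → E)} (hC : MeasurableSet C)
    (hdet : DeterminedBy n C) :
    ((iidLaw ν).restrict C).map (shift n) = iidLaw ν C • iidLaw ν := by
  ext B hB
  rw [Measure.map_apply (measurable_shift n) hB, Measure.restrict_apply (measurable_shift n hB),
    Set.inter_comm, measure_inter_preimage_shift ν hC hdet hB]
  simp

/-- The shift on sequences of independent identically distributed variables is ergodic. -/
lemma ergodic_shift : Ergodic (shift 1) (iidLaw ν) := by
  refine ⟨measurePreserving_shift ν 1, ⟨fun B hB hinv => ?_⟩⟩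
  rw [eventuallyConst_set']
  by_cases h0 : iidLaw ν B = 0
  · exact Or.inl (ae_eq_empty.2 h0)
  right
  have hinv' : ∀ n, shift n ⁻¹' B = B := fun n => by
    rw [← iterate_shift_one, Set.preimage_iterate_eq]
    exact Function.IsFixedPt.iterate hinv n
  have : IsProbabilityMeasure ((iidLaw ν)[|B]) := cond_isProbabilityMeasure h0
  -- An invariant `B` equals its preimage under a shift past all coordinates of a given box, hence
  -- is independent of that box. So conditioning on `B` does not change the law, and `B` has full
  -- measure.
  have key : (iidLaw ν)[|B] = iidLaw ν := by
    refine Measure.eq_infinitePi _ fun s t ht => ?_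
    have hm : MeasurableSet (Set.pi (s : Set ℕ) t) :=
      MeasurableSet.pi s.countable_toSet fun i _ => ht i
    have hd : DeterminedBy (s.sup id + 1) (Set.pi (s : Set ℕ) t) := by
      intro z z' h hz i hi
      rw [← h i (Nat.lt_succ_of_le (Finset.le_sup (f := id) hi))]
      exact hz i hi
    rw [cond_apply hB, Set.inter_comm]
    conv_lhs => rw [← hinv' (s.sup id + 1)]
    rw [measure_inter_preimage_shift ν hm hd hB, hinv', mul_comm, mul_assoc,
      ENNReal.mul_inv_cancel h0 (measure_ne_top _ _), mul_one,
      Measure.infinitePi_pi _ (fun i _ => ht i)]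
  rw [ae_eq_univ, ← key, cond_apply hB]
  simp

end

/-! ### Birkhoff's ergodic theorem -/

section

variable {Z : Type*}

/-- The maximum of the Birkhoff sums of `f` of order at most `N`. -/
def maxBirkhoffSum (T : Z → Z) (f : Z → ℝ) : ℕ → Z → ℝ
  | 0 => 0
  | N + 1 => fun x => max 0 (f x + maxBirkhoffSum T f N (T x))

lemma maxBirkhoffSum_nonneg (T : Z → Z) (f : Z → ℝ) (N : ℕ) (x : Z) :
    0 ≤ maxBirkhoffSum T f N x := by
  cases N with
  | zero => exact le_rfl
  | succ N => exact le_max_left _ _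

lemma maxBirkhoffSum_le_succ (T : Z → Z) (f : Z → ℝ) (N : ℕ) (x : Z) :
    maxBirkhoffSum T f N x ≤ maxBirkhoffSum T f (N + 1) x := by
  induction N generalizing x with
  | zero => exact maxBirkhoffSum_nonneg T f 1 x
  | succ N ih => exact max_le_max le_rfl (add_le_add le_rfl (ih _))

lemma maxBirkhoffSum_mono (T : Z → Z) (f : Z → ℝ) (x : Z) :
    Monotone fun N => maxBirkhoffSum T f N x :=
  monotone_nat_of_le_succ fun N => maxBirkhoffSum_le_succ T f N x

lemma birkhoffSum_le_maxBirkhoffSum (T : Z → Z) (f : Z → ℝ) (N : ℕ) (x : Z) :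
    birkhoffSum T f N x ≤ maxBirkhoffSum T f N x := by
  induction N generalizing x with
  | zero => simp [maxBirkhoffSum]
  | succ N ih =>
    rw [birkhoffSum_succ']
    exact (add_le_add le_rfl (ih _)).trans (le_max_right _ _)

variable [MeasurableSpace Z] {P : Measure Z} {T : Z → Z} {f : Z → ℝ}

lemma measurable_maxBirkhoffSum (hT : Measurable T) (hf : Measurable f) (N : ℕ) :
    Measurable (maxBirkhoffSum T f N) := by
  induction N with
  | zero => exact measurable_const
  | succ N ih => exact measurable_const.max (hf.add (ih.comp hT))

lemma integrable_maxBirkhoffSum (hT : MeasurePreserving T P P) (hf : Integrable f P) (N : ℕ) :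
    Integrable (maxBirkhoffSum T f N) P := by
  induction N with
  | zero => exact integrable_zero _ _ _
  | succ N ih =>
    exact (integrable_zero _ _ _).sup (hf.add (hT.integrable_comp_of_integrable ih))

/-- If the mean of `f` is negative, then its Birkhoff sums under an ergodic map are almost surely
bounded above. -/
lemma ae_bddAbove_birkhoffSum [IsProbabilityMeasure P] (hT : Ergodic T P) (hfm : Measurable f)
    (hf : Integrable f P) (hneg : ∫ x, f x ∂P < 0) :
    ∀ᵐ x ∂P, ∃ K : ℝ, ∀ n, birkhoffSum T f n x ≤ K := by
  set F := maxBirkhoffSum T f with hF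
  have hFm : ∀ N, Measurable (F N) := measurable_maxBirkhoffSum hT.measurable hfm
  set B : Set Z := {x | ∀ K : ℕ, ∃ N, (K : ℝ) < F N x} with hB
  have hBm : MeasurableSet B := by
    have : B = ⋂ K : ℕ, ⋃ N, {x | (K : ℝ) < F N x} := by ext; simp [hB]
    rw [this]
    exact .iInter fun K => .iUnion fun N => measurableSet_lt measurable_const (hFm N)
  -- By `F (N + 1) x = max 0 (f x + F N (T x))`, unboundedness at `x` and at `T x` are equivalent.
  have hinv : T ⁻¹' B = B := by
    ext x
    simp only [hB, Set.mem_preimage, Set.mem_ofPred_eq]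
    constructor
    · intro h K
      obtain ⟨M, hM⟩ := exists_nat_ge ((K : ℝ) - f x)
      obtain ⟨N, hN⟩ := h M
      refine ⟨N + 1, lt_max_of_lt_right ?_⟩
      change (K : ℝ) < f x + F N (T x)
      linarith
    · intro h K
      obtain ⟨M, hM⟩ := exists_nat_ge ((K : ℝ) + f x)
      obtain ⟨N, hN⟩ := h M
      have hN' := hN.trans_le (maxBirkhoffSum_le_succ T f N x)
      have hpos : ¬ (M : ℝ) < 0 := not_lt.2 M.cast_nonneg
      refine ⟨N, ?_⟩
      rcases lt_max_iff.1 hN' with h' | h'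
      · exact absurd h' hpos
      · change (M : ℝ) < f x + F N (T x) at h'
        linarith
  -- If `B` had full measure, `F (N + 1) - F N ∘ T` would equal `f` eventually, with `|f|` as a
  -- dominating function, so its integrals would tend to the negative number `∫ f`. But each of them
  -- is nonnegative, as `F` increases with `N` and `T` preserves `P`.
  have hnull : P B = 0 := by
    rcases hT.toPreErgodic.ae_empty_or_univ hBm hinv with h | h
    · exact ae_eq_empty.1 h
    exfalso
    have hB1 : ∀ᵐ x ∂P, x ∈ B := by
      filter_upwards [h.mem_iff] with x hx using hx.2 trivial
    have hlim : Tendsto (fun N => ∫ x, (F (N + 1) x - F N (T x)) ∂P) atTop (𝓝 (∫ x, f x ∂P)) := by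
      refine tendsto_integral_of_dominated_convergence (fun x => |f x|)
        (fun N => ((hFm _).sub ((hFm N).comp hT.measurable)).aestronglyMeasurable) hf.abs
        (fun N => ae_of_all _ fun x => ?_) ?_
      · have h0 := maxBirkhoffSum_nonneg T f N (T x)
        change |max 0 (f x + F N (T x)) - F N (T x)| ≤ _
        change 0 ≤ F N (T x) at h0
        rcases max_cases 0 (f x + F N (T x)) with ⟨h, h'⟩ | ⟨h, h'⟩ <;> rw [h]
        · rw [abs_le]; constructor <;> cases abs_cases (f x) <;> linarith
        · rw [add_sub_cancel_right]
      · filter_upwards [hB1] with x hx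
        have hx' : T x ∈ B := by rw [← Set.mem_preimage, hinv]; exact hx
        obtain ⟨M, hM⟩ := exists_nat_ge (-f x)
        obtain ⟨N₀, hN₀⟩ := hx' M
        refine tendsto_const_nhds.congr' ?_
        filter_upwards [eventually_ge_atTop N₀] with N hN
        have := maxBirkhoffSum_mono T f (T x) hN
        change f x = max 0 (f x + F N (T x)) - F N (T x)
        change F N₀ (T x) ≤ F N (T x) at this
        rw [max_eq_right (by linarith), add_sub_cancel_right]
    refine absurd (ge_of_tendsto' hlim fun N => ?_) (not_le.2 hneg)
    have hi : ∀ N, Integrable (F N) P := integrable_maxBirkhoffSum hT.toMeasurePreserving hf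
    have hi' : Integrable (fun x => F N (T x)) P :=
      hT.toMeasurePreserving.integrable_comp_of_integrable (hi N)
    rw [integral_sub (hi _) hi', sub_nonneg]
    have : ∫ x, F N (T x) ∂P = ∫ x, F N x ∂P := by
      rw [← integral_map hT.measurable.aemeasurable (hFm N).aestronglyMeasurable,
        hT.toMeasurePreserving.map_eq]
    rw [this]
    exact integral_mono (hi _) (hi _) (maxBirkhoffSum_le_succ T f N)
  have : ∀ᵐ x ∂P, x ∉ B := measure_eq_zero_iff_ae_notMem.1 hnull
  filter_upwards [this] with x hx
  simp only [hB, Set.mem_ofPred_eq, not_forall, not_exists, not_lt] at hx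
  obtain ⟨K, hK⟩ := hx
  exact ⟨K, fun n => (birkhoffSum_le_maxBirkhoffSum T f n x).trans (hK n)⟩

/-- Subtracting slightly more than the mean makes the mean negative, so the Birkhoff sums are
bounded above. The countably many excesses `1 / (j + 1)` suffice for all `ε`. -/
lemma ae_eventually_birkhoffSum_le [IsProbabilityMeasure P] (hT : Ergodic T P)
    (hfm : Measurable f) (hf : Integrable f P) :
    ∀ᵐ x ∂P, ∀ ε > 0, ∀ᶠ n : ℕ in atTop, birkhoffSum T f n x ≤ n * (∫ x, f x ∂P + ε) := by
  have h : ∀ᵐ x ∂P, ∀ j : ℕ, ∃ K : ℝ, ∀ n,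
      birkhoffSum T (fun x => f x - (∫ x, f x ∂P + 1 / (j + 1))) n x ≤ K := by
    refine ae_all_iff.2 fun j => ae_bddAbove_birkhoffSum hT (hfm.sub measurable_const)
      (hf.sub (integrable_const _)) ?_
    rw [integral_sub hf (integrable_const _)]
    simp only [integral_const, probReal_univ, one_smul]
    have : (0 : ℝ) < 1 / (j + 1) := by positivity
    linarith
  filter_upwards [h] with x hx ε hε
  obtain ⟨j, hj⟩ := exists_nat_one_div_lt (half_pos hε)
  obtain ⟨K, hK⟩ := hx j
  filter_upwards [eventually_ge_atTop ⌈K / (ε / 2)⌉₊] with n hn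
  have hn' : K ≤ n * (ε / 2) := by
    rw [← div_le_iff₀ (half_pos hε)]
    exact (Nat.le_ceil _).trans (by exact_mod_cast hn)
  have h1 := hK n
  simp only [birkhoffSum, Finset.sum_sub_distrib, Finset.sum_const, Finset.card_range,
    nsmul_eq_mul] at h1 ⊢
  have h2 : (n : ℝ) * (1 / (j + 1)) ≤ n * (ε / 2) :=
    mul_le_mul_of_nonneg_left hj.le n.cast_nonneg
  nlinarith

/-- **Birkhoff's pointwise ergodic theorem** for ergodic maps. -/
theorem ae_tendsto_birkhoffSum_div [IsProbabilityMeasure P] (hT : Ergodic T P)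
    (hfm : Measurable f) (hf : Integrable f P) :
    ∀ᵐ x ∂P, Tendsto (fun n : ℕ => birkhoffSum T f n x / n) atTop (𝓝 (∫ x, f x ∂P)) := by
  filter_upwards [ae_eventually_birkhoffSum_le hT hfm hf,
    ae_eventually_birkhoffSum_le hT hfm.neg hf.neg] with x h1 h2
  rw [Metric.tendsto_nhds]
  intro ε hε
  filter_upwards [h1 (ε / 2) (half_pos hε), h2 (ε / 2) (half_pos hε), eventually_gt_atTop 0]
    with n hn1 hn2 hn
  have hn' : (0 : ℝ) < n := by exact_mod_cast hn
  have hs : birkhoffSum T (-f) n x = - birkhoffSum T f n x := by simp [birkhoffSum]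
  simp only [hs, Pi.neg_apply, integral_neg] at hn2
  rw [Real.dist_eq, abs_lt]
  constructor
  · have : ∫ x, f x ∂P - ε / 2 ≤ birkhoffSum T f n x / n := by
      rw [le_div_iff₀ hn']; linarith
    linarith
  · have : birkhoffSum T f n x / n ≤ ∫ x, f x ∂P + ε / 2 := by
      rw [div_le_iff₀ hn']; linarith
    linarith

end

/-! ### Pathwise bounds for the Lindley recursion -/

/-- The sojourn times in a FIFO queue with service time `s` that is initially empty, where `d n` is
the time between the arrivals of the customers `n` and `n + 1`. -/
def sojourn (s : ℝ) (d : ℕ → ℝ) : ℕ → ℝ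
  | 0 => 0
  | n + 1 => max 0 (sojourn s d n - d n) + s

section Deterministic

variable {s : ℝ} {d : ℕ → ℝ}

lemma sojourn_nonneg (hs : 0 ≤ s) (n : ℕ) : 0 ≤ sojourn s d n := by
  cases n with
  | zero => exact le_rfl
  | succ n => exact add_nonneg (le_max_left _ _) hs

lemma sojourn_le (hs : 0 ≤ s) (hd : ∀ k, 0 ≤ d k) (n : ℕ) : sojourn s d n ≤ n * s := by
  induction n with
  | zero => simp [sojourn]
  | succ n ih =>
    have h : max 0 (sojourn s d n - d n) ≤ n * s :=
      max_le (by positivity) (by linarith [hd n])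
    simp only [sojourn]
    push_cast
    linarith

/-- The recursion is monotone in its starting value, and starting empty at customer `i` is the least
possible start. -/
lemma sojourn_shift_le (hs : 0 ≤ s) (i m : ℕ) :
    sojourn s (shift i d) m ≤ sojourn s d (i + m) := by
  induction m with
  | zero => exact sojourn_nonneg hs _
  | succ m ih =>
    exact add_le_add (max_le_max le_rfl (sub_le_sub ih le_rfl)) le_rfl

/-- This compares the queue with the one that ignores its first customer. Either the server has been
idle since, and then the two agree, or it has been busy throughout, and then the sojourn time is all
the work brought minus all the time elapsed. -/
lemma sojourn_succ_le_max (hd : ∀ k, 0 ≤ d k) (j : ℕ) :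
    sojourn s d (j + 1) ≤
      max (sojourn s (shift 1 d) j) ((j + 1) * s - ∑ l ∈ Finset.range j, d (1 + l)) := by
  induction j with
  | zero => simp [sojourn, hd 0]
  | succ j ih =>
    have h1 : sojourn s d (j + 1) - d (j + 1) ≤ max (sojourn s (shift 1 d) j - d (j + 1))
        ((j + 1) * s - ∑ l ∈ Finset.range j, d (1 + l) - d (j + 1)) := by
      rw [max_sub_sub_right]; linarith
    have h2 : sojourn s (shift 1 d) (j + 1) = max 0 (sojourn s (shift 1 d) j - d (j + 1)) + s := by
      simp only [sojourn, shift, add_comm]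
    rw [h2, sojourn, Finset.sum_range_succ, add_comm 1 j]
    push_cast
    rcases le_max_iff.1 h1 with h | h
    · exact le_max_of_le_left (add_le_add (max_le_max le_rfl h) le_rfl)
    · rcases max_cases 0 (sojourn s d (j + 1) - d (j + 1)) with ⟨h', -⟩ | ⟨h', -⟩ <;> rw [h']
      · exact le_max_of_le_left (add_le_add (le_max_left _ _) le_rfl)
      · exact le_max_of_le_right (by linarith)

/-- The exponential weight of the first `j` increments of the random walk that drives a queue. -/
def walkWeight (lam s : ℝ) (d : ℕ → ℝ) (j : ℕ) : ℝ :=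
  ∏ l ∈ Finset.range j, Real.exp (lam * (s - d l))

lemma walkWeight_nonneg (lam s : ℝ) (d : ℕ → ℝ) (j : ℕ) : 0 ≤ walkWeight lam s d j :=
  Finset.prod_nonneg fun _ _ => (Real.exp_pos _).le

lemma walkWeight_succ (lam s : ℝ) (d : ℕ → ℝ) (j : ℕ) :
    walkWeight lam s d (j + 1) = Real.exp (lam * (s - d 0)) * walkWeight lam s (shift 1 d) j := by
  simp only [walkWeight, Finset.prod_range_succ', mul_comm, shift, add_comm 1]

/-- The busy case is bounded through `y ≤ exp (lam * y) / lam`. It has one more service time than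
interarrival times, which gives the factor `exp (lam * s)`. -/
lemma sojourn_succ_le {lam : ℝ} (hs : 0 ≤ s) (hlam : 0 < lam) (hd : ∀ k, 0 ≤ d k) (j : ℕ) :
    sojourn s d (j + 1) ≤ sojourn s (shift 1 d) j +
      Real.exp (lam * s) / lam * walkWeight lam s (shift 1 d) j := by
  have h0 : 0 ≤ Real.exp (lam * s) / lam * walkWeight lam s (shift 1 d) j :=
    mul_nonneg (by positivity) (walkWeight_nonneg _ _ _ _)
  have h1 : ((j + 1) * s - ∑ l ∈ Finset.range j, d (1 + l)) ≤
      Real.exp (lam * s) / lam * walkWeight lam s (shift 1 d) j := by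
    have : Real.exp (lam * s) / lam * walkWeight lam s (shift 1 d) j =
        Real.exp (lam * ((j + 1) * s - ∑ l ∈ Finset.range j, d (1 + l))) / lam := by
      rw [walkWeight, ← Real.exp_sum, div_mul_eq_mul_div, ← Real.exp_add, ← Finset.mul_sum,
        Finset.sum_sub_distrib]
      simp only [Finset.sum_const, Finset.card_range, nsmul_eq_mul, shift]
      congr 2
      ring
    rw [this, le_div_iff₀ hlam, mul_comm]
    linarith [Real.add_one_le_exp (lam * ((j + 1) * s - ∑ l ∈ Finset.range j, d (1 + l)))]
  rcases le_max_iff.1 (sojourn_succ_le_max (s := s) hd j) with h | h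
  · linarith
  · linarith [sojourn_nonneg (d := shift 1 d) hs j]

/-- The first `i` customers are dropped one after the other. Dropping customer `k` costs the weight
of the walk with the remaining `i - 1 - k + m` increments. -/
lemma sojourn_add_le {lam : ℝ} (hs : 0 ≤ s) (hlam : 0 < lam) (hd : ∀ k, 0 ≤ d k) (i m : ℕ) :
    sojourn s d (i + m) ≤ sojourn s (shift i d) m + Real.exp (lam * s) / lam *
      ∑ k ∈ Finset.range i, walkWeight lam s (shift (k + 1) d) (i - 1 - k + m) := by
  induction i generalizing d with
  | zero => simp
  | succ i ih =>
    have h1 := sojourn_succ_le hs hlam hd (i + m)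
    have h2 := ih (d := shift 1 d) fun k => hd _
    rw [shift_shift, add_comm 1 i] at h2
    rw [Finset.sum_range_succ', mul_add, add_right_comm i 1 m]
    have h3 : ∑ k ∈ Finset.range i, walkWeight lam s (shift (k + 1) (shift 1 d)) (i - 1 - k + m) =
        ∑ k ∈ Finset.range i, walkWeight lam s (shift (k + 1 + 1) d) (i + 1 - 1 - (k + 1) + m) := by
      refine Finset.sum_congr rfl fun k _ => ?_
      rw [shift_shift, add_comm 1 (k + 1)]
      congr 1
      omega
    rw [h3] at h2
    simp only [Nat.add_sub_cancel, Nat.sub_zero, zero_add] at h1 h2 ⊢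
    linarith

/-- After exchanging the sums, the walks that start at a fixed customer have distinct lengths of at
least `m`, so each inner sum is part of one tail. -/
lemma sum_sum_walkWeight_le {lam : ℝ} {m : ℕ} {G : ℕ → ℝ}
    (hG : ∀ (k : ℕ) (t : Finset ℕ), ∑ j ∈ t, walkWeight lam s (shift k d) (j + m) ≤ G k) (n : ℕ) :
    ∑ i ∈ Finset.range n, ∑ k ∈ Finset.range i,
      walkWeight lam s (shift (k + 1) d) (i - 1 - k + m) ≤ ∑ k ∈ Finset.range n, G (k + 1) := by
  rw [Finset.sum_comm' (t' := Finset.range n) (s' := fun k => Finset.Ioo k n)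
    (by intro i k; simp; omega)]
  refine Finset.sum_le_sum fun k _ => ?_
  have h := hG (k + 1) ((Finset.Ioo k n).image fun i => i - 1 - k)
  rwa [Finset.sum_image] at h
  intro i hi j hj hij
  simp at hi hj hij
  omega

end Deterministic

/-! ### Exponential weights of random walks with negative drift -/

section Queue

variable {B : Type*} [MeasurableSpace B] {ν : Measure B} [IsProbabilityMeasure ν]
  {D : B → ℝ} {s : ℝ}

lemma measurable_sojourn (hD : Measurable D) (s : ℝ) (n : ℕ) :
    Measurable fun b : ℕ → B => sojourn s (D ∘ b) n := by
  induction n with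
  | zero => exact measurable_const
  | succ n ih =>
    exact (measurable_const.max (ih.sub (hD.comp (measurable_pi_apply n)))).add_const s

lemma integrable_sojourn (hD : Measurable D) (hD0 : ∀ x, 0 ≤ D x) (hs : 0 ≤ s) (n : ℕ) :
    Integrable (fun b : ℕ → B => sojourn s (D ∘ b) n) (iidLaw ν) :=
  Integrable.of_bound (measurable_sojourn hD s n).aestronglyMeasurable (n * s)
    (ae_of_all _ fun _ => by
      rw [Real.norm_of_nonneg (sojourn_nonneg hs n)]
      exact sojourn_le hs (fun _ => hD0 _) n)

lemma measurable_walkWeight (hD : Measurable D) (lam s : ℝ) (j : ℕ) :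
    Measurable fun b : ℕ → B => walkWeight lam s (D ∘ b) j := by
  unfold walkWeight
  exact Finset.measurable_prod _ fun l _ => Real.measurable_exp.comp
    (measurable_const.mul (measurable_const.sub (hD.comp (measurable_pi_apply l))))

lemma lintegral_walkWeight (hD : Measurable D) (lam s : ℝ) (j : ℕ) :
    ∫⁻ b, ENNReal.ofReal (walkWeight lam s (D ∘ b) j) ∂iidLaw ν =
      (∫⁻ x, ENNReal.ofReal (Real.exp (lam * (s - D x))) ∂ν) ^ j := by
  induction j with
  | zero => simp [walkWeight]
  | succ j ih =>
    have he : Measurable fun x => ENNReal.ofReal (Real.exp (lam * (s - D x))) := by fun_prop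
    have hw := (measurable_walkWeight hD lam s (j + 1)).ennreal_ofReal
    rw [← (measurePreserving_splice ν 1).lintegral_comp hw]
    have h : ∀ z : (ℕ → B) × (ℕ → B),
        ENNReal.ofReal (walkWeight lam s (D ∘ splice 1 z) (j + 1)) =
        ENNReal.ofReal (Real.exp (lam * (s - D (z.1 0)))) *
          ENNReal.ofReal (walkWeight lam s (D ∘ z.2) j) := by
      intro z
      rw [walkWeight_succ, ENNReal.ofReal_mul (Real.exp_pos _).le]
      rw [show shift 1 (D ∘ splice 1 z) = D ∘ z.2 by rw [← shift_splice 1 z]; rfl]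
      rfl
    simp only [h]
    rw [lintegral_prod_mul
      (f := fun b : ℕ → B => ENNReal.ofReal (Real.exp (lam * (s - D (b 0)))))
      (g := fun b : ℕ → B => ENNReal.ofReal (walkWeight lam s (D ∘ b) j))
      (he.comp (measurable_pi_apply 0)).aemeasurable
      (measurable_walkWeight hD lam s j).ennreal_ofReal.aemeasurable, ih, pow_succ, mul_comm]
    congr 1
    have := (measurePreserving_eval_infinitePi (fun _ : ℕ => ν) 0).lintegral_comp he
    simpa using this

/-- A Chernoff bound that needs only a first moment, because `D ≥ 0` enters with a negative sign:
`exp (-lam * D) ≤ 1 - lam * (D / (1 + lam * D))`, and the mean of the last quotient tends to that of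
`D` as `lam → 0`, hence exceeds `s` for small `lam`. Then the expectation is below `exp (lam * s) *
(1 - lam * s) ≤ 1`. -/
lemma exists_lintegral_exp_lt_one (hD : Measurable D) (hD0 : ∀ x, 0 ≤ D x) (hDi : Integrable D ν)
    (hlt : s < ∫ x, D x ∂ν) :
    ∃ lam > 0, ∫⁻ x, ENNReal.ofReal (Real.exp (lam * (s - D x))) ∂ν < 1 := by
  have hlim : Tendsto (fun n : ℕ => ∫ x, D x / (1 + 1 / ((n : ℝ) + 1) * D x) ∂ν) atTop
      (𝓝 (∫ x, D x ∂ν)) := by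
    refine tendsto_integral_of_dominated_convergence D
      (fun n => (by fun_prop : Measurable _).aestronglyMeasurable) hDi (fun n => ?_) ?_
    · refine ae_of_all _ fun x => ?_
      have := hD0 x
      rw [Real.norm_of_nonneg (by positivity)]
      refine div_le_self this ?_
      have : 0 ≤ 1 / ((n : ℝ) + 1) * D x := by positivity
      linarith
    · refine ae_of_all _ fun x => ?_
      have h := (tendsto_one_div_add_atTop_nhds_zero_nat (𝕜 := ℝ)).mul_const (D x)
      have h2 : Tendsto (fun n : ℕ => D x / (1 + 1 / ((n : ℝ) + 1) * D x)) atTop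
          (𝓝 (D x / (1 + 0 * D x))) := tendsto_const_nhds.div (h.const_add 1) (by simp)
      simpa using h2
  obtain ⟨n, hn⟩ := (hlim.eventually (lt_mem_nhds hlt)).exists
  set lam : ℝ := 1 / ((n : ℝ) + 1) with hlam
  have hpos : 0 < lam := by positivity
  refine ⟨lam, hpos, ?_⟩
  have hb : ∀ x, Real.exp (-(lam * D x)) ≤ 1 - lam * (D x / (1 + lam * D x)) := by
    intro x
    have h0 : 0 ≤ lam * D x := mul_nonneg hpos.le (hD0 x)
    rw [Real.exp_neg, inv_le_iff_one_le_mul₀ (Real.exp_pos _)]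
    have h1 : 1 - lam * (D x / (1 + lam * D x)) = 1 / (1 + lam * D x) := by
      field_simp
      ring
    rw [h1, div_mul_eq_mul_div, one_mul, le_div_iff₀ (by positivity)]
    linarith [Real.add_one_le_exp (lam * D x)]
  have hi : Integrable (fun x => D x / (1 + lam * D x)) ν := by
    refine hDi.mono (by fun_prop : Measurable _).aestronglyMeasurable (ae_of_all _ fun x => ?_)
    have := hD0 x
    have h0 : 0 ≤ lam * D x := mul_nonneg hpos.le this
    rw [Real.norm_of_nonneg (by positivity), Real.norm_of_nonneg this]
    exact div_le_self this (by linarith)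
  have hi' : Integrable (fun x => Real.exp (lam * s) * (1 - lam * (D x / (1 + lam * D x)))) ν :=
    ((integrable_const _).sub (hi.const_mul lam)).const_mul _
  calc ∫⁻ x, ENNReal.ofReal (Real.exp (lam * (s - D x))) ∂ν
      ≤ ∫⁻ x, ENNReal.ofReal (Real.exp (lam * s) * (1 - lam * (D x / (1 + lam * D x)))) ∂ν := by
        refine lintegral_mono fun x => ENNReal.ofReal_le_ofReal ?_
        rw [mul_sub, sub_eq_add_neg, Real.exp_add]
        exact mul_le_mul_of_nonneg_left (hb x) (Real.exp_pos _).le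
    _ = ENNReal.ofReal (Real.exp (lam * s) *
          (1 - lam * ∫ x, D x / (1 + lam * D x) ∂ν)) := by
        rw [← ofReal_integral_eq_lintegral_ofReal hi' (ae_of_all _ fun x =>
          mul_nonneg (Real.exp_pos _).le ((Real.exp_pos _).le.trans (hb x))),
          integral_const_mul, integral_sub (integrable_const _) (hi.const_mul lam),
          integral_const_mul]
        simp
    _ < 1 := by
        rw [ENNReal.ofReal_lt_one]
        have h1 : 1 - lam * ∫ x, D x / (1 + lam * D x) ∂ν < Real.exp (-(lam * s)) := by
          have := Real.add_one_le_exp (-(lam * s))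
          have := mul_lt_mul_of_pos_left hn hpos
          linarith
        calc _ < Real.exp (lam * s) * Real.exp (-(lam * s)) :=
              mul_lt_mul_of_pos_left h1 (Real.exp_pos _)
          _ = 1 := by rw [← Real.exp_add]; simp

/-- Birkhoff's theorem for the shift on independent identically distributed variables. -/
lemma ae_tendsto_sum_shift_div {f : (ℕ → B) → ℝ} (hfm : Measurable f)
    (hf : Integrable f (iidLaw ν)) :
    ∀ᵐ b ∂iidLaw ν, Tendsto (fun n : ℕ => (∑ i ∈ Finset.range n, f (shift i b)) / n) atTop
      (𝓝 (∫ b, f b ∂iidLaw ν)) := by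
  filter_upwards [ae_tendsto_birkhoffSum_div (ergodic_shift ν) hfm hf] with b hb
  simpa only [birkhoffSum, iterate_shift_one] using hb

/-- The total weight of all walks of length at least `m`. -/
def tailWeight (lam s : ℝ) (D : B → ℝ) (m : ℕ) (b : ℕ → B) : ℝ :=
  (∑' j, ENNReal.ofReal (walkWeight lam s (D ∘ b) (j + m))).toReal

lemma lintegral_tailWeight_tsum (hD : Measurable D) (lam s : ℝ) (m : ℕ) :
    ∫⁻ b, ∑' j, ENNReal.ofReal (walkWeight lam s (D ∘ b) (j + m)) ∂iidLaw ν =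
      (1 - ∫⁻ x, ENNReal.ofReal (Real.exp (lam * (s - D x))) ∂ν)⁻¹ *
        (∫⁻ x, ENNReal.ofReal (Real.exp (lam * (s - D x))) ∂ν) ^ m := by
  rw [lintegral_tsum fun j => (measurable_walkWeight hD lam s _).ennreal_ofReal.aemeasurable]
  simp only [lintegral_walkWeight hD, pow_add]
  rw [ENNReal.tsum_mul_right, ENNReal.tsum_geometric]

lemma measurable_tailWeight (hD : Measurable D) (lam s : ℝ) (m : ℕ) :
    Measurable (tailWeight lam s D m) :=
  (Measurable.tsum fun _ =>
    (measurable_walkWeight hD lam s _).ennreal_ofReal).ennreal_toReal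

variable {lam : ℝ}

lemma lintegral_tailWeight_tsum_ne_top (hD : Measurable D)
    (hlt : ∫⁻ x, ENNReal.ofReal (Real.exp (lam * (s - D x))) ∂ν < 1) (m : ℕ) :
    ∫⁻ b, ∑' j, ENNReal.ofReal (walkWeight lam s (D ∘ b) (j + m)) ∂iidLaw ν ≠ ⊤ := by
  rw [lintegral_tailWeight_tsum hD]
  refine ENNReal.mul_ne_top ?_ (ENNReal.pow_ne_top hlt.ne_top)
  rw [ENNReal.inv_ne_top]
  exact (tsub_pos_of_lt hlt).ne'

lemma integrable_tailWeight (hD : Measurable D)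
    (hlt : ∫⁻ x, ENNReal.ofReal (Real.exp (lam * (s - D x))) ∂ν < 1) (m : ℕ) :
    Integrable (tailWeight lam s D m) (iidLaw ν) :=
  integrable_toReal_of_lintegral_ne_top
    (Measurable.tsum fun _ =>
      (measurable_walkWeight hD lam s _).ennreal_ofReal).aemeasurable
    (lintegral_tailWeight_tsum_ne_top hD hlt m)

lemma tendsto_integral_tailWeight (hD : Measurable D)
    (hlt : ∫⁻ x, ENNReal.ofReal (Real.exp (lam * (s - D x))) ∂ν < 1) :
    Tendsto (fun m => ∫ b, tailWeight lam s D m b ∂iidLaw ν) atTop (𝓝 0) := by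
  have h : ∀ m, ∫ b, tailWeight lam s D m b ∂iidLaw ν =
      ((1 - ∫⁻ x, ENNReal.ofReal (Real.exp (lam * (s - D x))) ∂ν)⁻¹ *
        (∫⁻ x, ENNReal.ofReal (Real.exp (lam * (s - D x))) ∂ν) ^ m).toReal := by
    intro m
    have hm : Measurable fun b : ℕ → B =>
        ∑' j, ENNReal.ofReal (walkWeight lam s (D ∘ b) (j + m)) :=
      Measurable.tsum fun _ => (measurable_walkWeight hD lam s _).ennreal_ofReal
    rw [← lintegral_tailWeight_tsum hD]
    exact integral_toReal hm.aemeasurable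
      (ae_lt_top hm (lintegral_tailWeight_tsum_ne_top hD hlt m))
  simp only [h, ENNReal.toReal_mul, ENNReal.toReal_pow]
  have h1 : (∫⁻ x, ENNReal.ofReal (Real.exp (lam * (s - D x))) ∂ν).toReal < 1 := by
    rw [← ENNReal.toReal_one]
    exact ENNReal.toReal_strict_mono ENNReal.one_ne_top hlt
  simpa using (tendsto_pow_atTop_nhds_zero_of_lt_one ENNReal.toReal_nonneg h1).const_mul _

/-- The `toReal` in `tailWeight` sends a divergent series to `0`, so the bound requires convergence.
It holds almost surely for all `m` and all shifts at once. -/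
lemma ae_sum_walkWeight_le (hD : Measurable D)
    (hlt : ∫⁻ x, ENNReal.ofReal (Real.exp (lam * (s - D x))) ∂ν < 1) :
    ∀ᵐ b ∂iidLaw ν, ∀ (m k : ℕ) (t : Finset ℕ),
      ∑ j ∈ t, walkWeight lam s (shift k (D ∘ b)) (j + m) ≤ tailWeight lam s D m (shift k b) := by
  have h : ∀ m, ∀ᵐ b ∂iidLaw ν,
      ∑' j, ENNReal.ofReal (walkWeight lam s (D ∘ b) (j + m)) < ⊤ := fun m =>
    ae_lt_top (Measurable.tsum fun _ =>
      (measurable_walkWeight hD lam s _).ennreal_ofReal)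
      (lintegral_tailWeight_tsum_ne_top hD hlt m)
  have h' : ∀ᵐ b ∂iidLaw ν, ∀ m k : ℕ,
      ∑' j, ENNReal.ofReal (walkWeight lam s (D ∘ shift k b) (j + m)) < ⊤ :=
    ae_all_iff.2 fun m => ae_all_iff.2 fun k =>
      (measurePreserving_shift ν k).quasiMeasurePreserving.ae (h m)
  filter_upwards [h'] with b hb m k t
  unfold tailWeight
  rw [← ENNReal.ofReal_le_iff_le_toReal (hb m k).ne,
    ENNReal.ofReal_sum_of_nonneg fun _ _ => walkWeight_nonneg _ _ _ _]
  exact ENNReal.sum_le_tsum t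

end Queue

/-! ### Long-run averages of sojourn times, stable and unstable -/

section Queue

variable {B : Type*} [MeasurableSpace B] {ν : Measure B} [IsProbabilityMeasure ν]
  {D : B → ℝ} {s : ℝ}

/-- In a stable queue with independent identically distributed interarrival times, weighted
averages of the sojourn times converge almost surely to a constant. -/
theorem exists_ae_tendsto_sum_sojourn_div (hD : Measurable D) (hD0 : ∀ x, 0 ≤ D x)
    (hDi : Integrable D ν) (hs : 0 ≤ s) (hlt : s < ∫ x, D x ∂ν) {w : B → ℝ} (hw : Measurable w)
    (hw0 : ∀ x, 0 ≤ w x) {K : ℝ} (hwK : ∀ x, w x ≤ K) :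
    ∃ c : ℝ, ∀ᵐ b ∂iidLaw ν, Tendsto
      (fun n : ℕ => (∑ i ∈ Finset.range n, w (b i) * sojourn s (D ∘ b) (i + 1)) / n)
      atTop (𝓝 c) := by
  obtain ⟨lam, hlam, hlam1⟩ := exists_lintegral_exp_lt_one hD hD0 hDi hlt
  set C := Real.exp (lam * s) / lam with hC
  have hC0 : 0 ≤ C := by positivity
  have hK0 : 0 ≤ K := by
    obtain ⟨x⟩ : Nonempty B := nonempty_of_isProbabilityMeasure ν
    exact (hw0 x).trans (hwK x)
  -- Evaluated at `shift i b`, this is the weighted sojourn time of a customer in the queue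
  -- restarted empty `m + 1` customers earlier. Being a fixed function of a shifted i.i.d. sequence,
  -- it has averages given by Birkhoff's theorem.
  set f : ℕ → (ℕ → B) → ℝ := fun m b => w (b m) * sojourn s (D ∘ b) (m + 1) with hf
  have hfm : ∀ m, Measurable (f m) := fun m =>
    (hw.comp (measurable_pi_apply m)).mul (measurable_sojourn hD s _)
  have hsoj : ∀ (b : ℕ → B) n, 0 ≤ sojourn s (D ∘ b) n := fun b n => sojourn_nonneg hs n
  have hf0 : ∀ m b, 0 ≤ f m b := fun m b => mul_nonneg (hw0 _) (hsoj _ _)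
  have hfi : ∀ m, Integrable (f m) (iidLaw ν) := fun m =>
    (integrable_sojourn hD hD0 hs (m + 1)).bdd_mul (c := K)
      (hw.comp (measurable_pi_apply m)).aestronglyMeasurable
      (ae_of_all _ fun b => by
        rw [Real.norm_of_nonneg (hw0 _)]
        exact hwK _)
  set a : ℕ → ℝ := fun m => ∫ b, f m b ∂iidLaw ν with ha
  set e : ℕ → ℝ := fun m => K * C * ∫ b, tailWeight lam s D (m + 1) (shift 1 b) ∂iidLaw ν with he
  have htm : ∀ m, Measurable fun b : ℕ → B => tailWeight lam s D (m + 1) (shift 1 b) := fun m =>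
    (measurable_tailWeight hD lam s _).comp (measurable_shift 1)
  have hti : ∀ m, Integrable (fun b => tailWeight lam s D (m + 1) (shift 1 b)) (iidLaw ν) :=
    fun m => (measurePreserving_shift ν 1).integrable_comp_of_integrable
      (integrable_tailWeight hD hlam1 _)
  have he0 : Tendsto e atTop (𝓝 0) := by
    have h : ∀ m, e m = K * C * ∫ b, tailWeight lam s D (m + 1) b ∂iidLaw ν := fun m => by
      simp only [he]
      congr 1
      conv_rhs => rw [← (measurePreserving_shift ν 1).map_eq]
      exact (integral_map (measurable_shift 1).aemeasurable
        (measurable_tailWeight hD lam s _).aestronglyMeasurable).symm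
    have := ((tendsto_integral_tailWeight hD hlam1).comp (tendsto_add_atTop_nat 1)).const_mul (K * C)
    simp only [mul_zero] at this
    exact this.congr fun m => (h m).symm
  -- Restarting the queue lowers the averages, which gives the limit `a m` as a lower bound. The
  -- loss is at most the averages of the tail weights, which give `e m`.
  have key : ∀ᵐ b ∂iidLaw ν, ∀ m, ∀ δ > 0, ∀ᶠ n : ℕ in atTop,
      a m - δ ≤ (∑ i ∈ Finset.range n, w (b i) * sojourn s (D ∘ b) (i + 1)) / n ∧
      (∑ i ∈ Finset.range n, w (b i) * sojourn s (D ∘ b) (i + 1)) / n ≤ a m + e m + δ := by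
    filter_upwards [ae_all_iff.2 fun m => ae_tendsto_sum_shift_div (hfm m) (hfi m),
      ae_all_iff.2 fun m => ae_tendsto_sum_shift_div (htm m) (hti m),
      ae_sum_walkWeight_le hD hlam1] with b hb1 hb2 hb3 m δ hδ
    set A : ℕ → ℝ := fun n => ∑ i ∈ Finset.range n, w (b i) * sojourn s (D ∘ b) (i + 1) with hA
    set I : ℕ → ℝ := fun n => ∑ i ∈ Finset.range n, f m (shift i b) with hI
    set J : ℕ → ℝ := fun n => ∑ k ∈ Finset.range n, tailWeight lam s D (m + 1) (shift 1 (shift k b))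
      with hJ
    have hshift : ∀ n, A (n + m) = A m +
        ∑ i ∈ Finset.range n, w (b (i + m)) * sojourn s (D ∘ b) (i + (m + 1)) := fun n => by
      simp only [hA]
      rw [add_comm n m, Finset.sum_range_add]
      congr 1
      refine Finset.sum_congr rfl fun i _ => ?_
      rw [add_comm m i, add_assoc]
    have hA0 : 0 ≤ A m := Finset.sum_nonneg fun i _ => mul_nonneg (hw0 _) (hsoj _ _)
    have hlow : ∀ n, I n ≤ A (n + m) := fun n => by
      rw [hshift]
      refine le_add_of_nonneg_of_le hA0 (Finset.sum_le_sum fun i _ => ?_)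
      exact mul_le_mul_of_nonneg_left (sojourn_shift_le (d := D ∘ b) hs i (m + 1)) (hw0 _)
    have hup : ∀ n, A (n + m) ≤ A m + I n + K * C * J n := fun n => by
      have h1 : ∀ i, w (b (i + m)) * sojourn s (D ∘ b) (i + (m + 1)) ≤
          f m (shift i b) + K * C * ∑ k ∈ Finset.range i,
            walkWeight lam s (shift (k + 1) (D ∘ b)) (i - 1 - k + (m + 1)) := fun i => by
        have h2 := sojourn_add_le hs hlam (d := D ∘ b) (fun k => hD0 _) i (m + 1)
        have h3 : 0 ≤ C * ∑ k ∈ Finset.range i,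
            walkWeight lam s (shift (k + 1) (D ∘ b)) (i - 1 - k + (m + 1)) :=
          mul_nonneg hC0 (Finset.sum_nonneg fun _ _ => walkWeight_nonneg _ _ _ _)
        calc _ ≤ w (b (i + m)) * (sojourn s (shift i (D ∘ b)) (m + 1) + _) :=
              mul_le_mul_of_nonneg_left h2 (hw0 _)
          _ ≤ _ := by
              rw [mul_add, mul_assoc K]
              exact add_le_add le_rfl (mul_le_mul_of_nonneg_right (hwK _) h3)
      have h4 := sum_sum_walkWeight_le (s := s) (d := D ∘ b) (lam := lam) (m := m + 1)
        (G := fun k => tailWeight lam s D (m + 1) (shift k b)) (fun k t => hb3 (m + 1) k t) n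
      have h5 : ∑ k ∈ Finset.range n, tailWeight lam s D (m + 1) (shift (k + 1) b) = J n := by
        simp only [hJ, shift_shift]
      rw [h5] at h4
      rw [hshift, add_assoc]
      refine add_le_add le_rfl ((Finset.sum_le_sum fun i _ => h1 i).trans ?_)
      rw [Finset.sum_add_distrib, ← Finset.mul_sum]
      exact add_le_add le_rfl (mul_le_mul_of_nonneg_left h4 (mul_nonneg hK0 hC0))
    -- The sums with `n` and with `n + m` terms may be divided by either number without changing the
    -- limit.
    have hratio : Tendsto (fun n : ℕ => (n : ℝ) / ((n + m : ℕ) : ℝ)) atTop (𝓝 1) := by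
      have := tendsto_natCast_div_add_atTop (𝕜 := ℝ) (m : ℝ)
      exact this.congr fun n => by push_cast; rfl
    have hscale : ∀ {u : ℕ → ℝ} {c : ℝ}, Tendsto (fun n : ℕ => u n / n) atTop (𝓝 c) →
        Tendsto (fun n : ℕ => u n / ((n + m : ℕ) : ℝ)) atTop (𝓝 c) := fun {u c} hu => by
      have := hu.mul hratio
      rw [mul_one] at this
      refine this.congr' ?_
      filter_upwards [eventually_gt_atTop 0] with n hn
      have : (n : ℝ) ≠ 0 := by positivity
      field_simp
    have hconst : Tendsto (fun n : ℕ => A m / ((n + m : ℕ) : ℝ)) atTop (𝓝 0) :=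
      tendsto_const_nhds.div_atTop
        (tendsto_natCast_atTop_atTop.comp (tendsto_add_atTop_nat m))
    have hlim1 := hscale (hb1 m)
    have hlim2 := (hconst.add hlim1).add ((hscale (hb2 m)).const_mul (K * C))
    rw [zero_add] at hlim2
    have hev : ∀ᶠ n : ℕ in atTop, a m - δ ≤ A (n + m) / ((n + m : ℕ) : ℝ) ∧
        A (n + m) / ((n + m : ℕ) : ℝ) ≤ a m + e m + δ := by
      filter_upwards [hlim1.eventually (lt_mem_nhds (sub_lt_self _ hδ)),
        hlim2.eventually (gt_mem_nhds (lt_add_of_pos_right _ hδ))] with n h1 h2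
      constructor
      · exact h1.le.trans (div_le_div_of_nonneg_right (hlow n) (Nat.cast_nonneg _))
      · refine le_trans ?_ h2.le
        rw [← mul_div_assoc, ← add_div, ← add_div]
        exact div_le_div_of_nonneg_right (hup n) (Nat.cast_nonneg _)
    rw [eventually_atTop] at hev ⊢
    obtain ⟨N, hN⟩ := hev
    refine ⟨N + m, fun n hn => ?_⟩
    have := hN (n - m) (by omega)
    rwa [Nat.sub_add_cancel (by omega)] at this
  -- At a common sample point, the lower bound for `m` and the upper bound for `m'` enclose the same
  -- averages. So the supremum of `a` is finite and lies within `e m` above each `a m`, and `e m →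
  -- 0`.
  have hae : ∀ m m', a m ≤ a m' + e m' := by
    obtain ⟨b, hb⟩ := key.exists
    intro m m'
    refine le_of_forall_pos_le_add fun δ hδ => ?_
    obtain ⟨n, h1, h2⟩ := ((hb m (δ / 2) (half_pos hδ)).and (hb m' (δ / 2) (half_pos hδ))).exists
    linarith [h1.1, h2.2]
  have hbdd : BddAbove (Set.range a) := ⟨a 0 + e 0, by rintro _ ⟨m, rfl⟩; exact hae m 0⟩
  refine ⟨⨆ m, a m, ?_⟩
  filter_upwards [key] with b hb
  rw [Metric.tendsto_nhds]
  intro ε hε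
  obtain ⟨m, hm⟩ := (he0.eventually (gt_mem_nhds (show (0 : ℝ) < ε / 2 by positivity))).exists
  filter_upwards [hb m (ε / 2) (half_pos hε)] with n hn
  have h1 : a m ≤ ⨆ m, a m := le_ciSup hbdd m
  have h2 : ⨆ m, a m ≤ a m + e m := ciSup_le fun m' => hae m' m
  have h3 : ∃ m', ⨆ m, a m < a m' + ε / 4 := by
    obtain ⟨m', hm'⟩ := exists_lt_of_lt_ciSup (show (⨆ m, a m) - ε / 4 < ⨆ m, a m by linarith)
    exact ⟨m', by linarith⟩
  rw [Real.dist_eq, abs_lt]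
  constructor <;> linarith [hn.1, hn.2]

/-- In a queue whose mean interarrival time is at most the service time and whose interarrival
times are unbounded, the mean of the sojourn time of the `n`-th customer is unbounded. -/
lemma exists_lt_integral_sojourn (hD : Measurable D) (hD0 : ∀ x, 0 ≤ D x) (hDi : Integrable D ν)
    (hs : 0 ≤ s) (hle : ∫ x, D x ∂ν ≤ s) (hunb : ∀ K : ℝ, ν {x | K < D x} ≠ 0) (M : ℝ) :
    ∃ n, M < ∫ b, sojourn s (D ∘ b) (n + 1) ∂iidLaw ν := by
  by_contra! hM
  have hM0 : 0 ≤ M := (integral_nonneg fun b => sojourn_nonneg hs 1).trans (hM 0)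
  have hM' : ∀ n, ∫ b, sojourn s (D ∘ b) n ∂iidLaw ν ≤ M := fun n => by
    cases n with
    | zero => simpa [sojourn] using hM0
    | succ n => exact hM n
  have hi := integrable_sojourn (ν := ν) hD hD0 hs
  have hm := measurable_sojourn hD s
  -- With means at most `M`, Markov's inequality puts the sojourn time below `R` with probability at
  -- least `1 / 2`. Independently of that, the next interarrival time exceeds `R + 1` with
  -- probability `2 * δ`.
  set R := 2 * M + 1 with hR
  set δ := ν.real {x | R + 1 < D x} / 2 with hδ
  have hδ0 : 0 < δ := half_pos (ENNReal.toReal_pos (hunb _) (measure_ne_top _ _))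
  have hDn : ∀ n, Integrable (fun b : ℕ → B => D (b n)) (iidLaw ν) := fun n =>
    (measurePreserving_eval_infinitePi (fun _ : ℕ => ν) n).integrable_comp_of_integrable hDi
  have hDint : ∀ n, ∫ b : ℕ → B, D (b n) ∂iidLaw ν = ∫ x, D x ∂ν := fun n => by
    conv_rhs => rw [← (measurePreserving_eval_infinitePi (fun _ : ℕ => ν) n).map_eq]
    exact (integral_map (measurable_pi_apply n).aemeasurable hD.aestronglyMeasurable).symm
  -- On that event, truncation at `0` gains at least `1` over the untruncated difference, whose mean
  -- drift is nonnegative. So the mean grows by at least `δ` each time, which contradicts its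
  -- boundedness.
  have hstep : ∀ n, ∫ b, sojourn s (D ∘ b) n ∂iidLaw ν + δ ≤
      ∫ b, sojourn s (D ∘ b) (n + 1) ∂iidLaw ν := by
    intro n
    set C : Set (ℕ → B) := {b | sojourn s (D ∘ b) n ≤ R} with hC
    set U : Set (ℕ → B) := {b | R + 1 < D (b 0)} with hU
    have hCm : MeasurableSet C := measurableSet_le (hm n) measurable_const
    have hUm : MeasurableSet U := measurableSet_lt measurable_const
      (hD.comp (measurable_pi_apply 0))
    have hdet : DeterminedBy n C := by
      intro z z' h hz
      have : ∀ k ≤ n, sojourn s (D ∘ z) k = sojourn s (D ∘ z') k := by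
        intro k
        induction k with
        | zero => exact fun _ => rfl
        | succ k ih =>
          intro hk
          simp only [sojourn, ih (by omega), Function.comp, h k (by omega)]
      simp only [hC, Set.mem_ofPred_eq] at hz ⊢
      rwa [← this n le_rfl]
    have hCprob : 1 / 2 ≤ (iidLaw ν).real C := by
      have h1 : R * (iidLaw ν).real Cᶜ ≤ M := by
        refine le_trans ?_ (hM' n)
        refine le_trans ?_ (mul_meas_ge_le_integral_of_nonneg
          (ae_of_all _ fun b => sojourn_nonneg hs n) (hi n) R)
        refine mul_le_mul_of_nonneg_left (measureReal_mono fun b hb => ?_) (by positivity)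
        simp only [hC, Set.mem_compl_iff, Set.mem_ofPred_eq, not_le] at hb
        exact hb.le
      rw [probReal_compl_eq_one_sub hCm] at h1
      by_contra! hlt
      nlinarith
    have hUprob : (iidLaw ν).real U = ν.real {x | R + 1 < D x} := by
      have := (measurePreserving_eval_infinitePi (fun _ : ℕ => ν) 0).measure_preimage
        (measurableSet_lt measurable_const hD : MeasurableSet {x | R + 1 < D x}).nullMeasurableSet
      simp only [measureReal_def]
      rw [← this]
      rfl
    have hCU : δ ≤ (iidLaw ν).real (C ∩ shift n ⁻¹' U) := by
      rw [measureReal_def, measure_inter_preimage_shift ν hCm hdet hUm, ENNReal.toReal_mul,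
        ← measureReal_def, ← measureReal_def, hUprob]
      have : (0 : ℝ) ≤ ν.real {x | R + 1 < D x} := measureReal_nonneg
      rw [hδ]
      nlinarith
    have hset : MeasurableSet (C ∩ shift n ⁻¹' U) := hCm.inter (measurable_shift n hUm)
    have hpt : ∀ b, sojourn s (D ∘ b) n - D (b n) + s + (C ∩ shift n ⁻¹' U).indicator 1 b ≤
        sojourn s (D ∘ b) (n + 1) := by
      intro b
      simp only [sojourn, Function.comp]
      by_cases hb : b ∈ C ∩ shift n ⁻¹' U
      · have h1 : sojourn s (D ∘ b) n ≤ R := hb.1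
        have h2 : R + 1 < D (b n) := hb.2
        rw [Set.indicator_of_mem hb]
        have := le_max_left 0 (sojourn s (D ∘ b) n - D (b n))
        simp only [Pi.one_apply]
        linarith
      · rw [Set.indicator_of_notMem hb]
        have := le_max_right 0 (sojourn s (D ∘ b) n - D (b n))
        linarith
    have hi1 : Integrable (fun b => sojourn s (D ∘ b) n - D (b n)) (iidLaw ν) :=
      (hi n).sub (hDn n)
    have hi2 : Integrable (fun b => sojourn s (D ∘ b) n - D (b n) + s) (iidLaw ν) :=
      hi1.add (integrable_const _)
    have hi3 : Integrable ((C ∩ shift n ⁻¹' U).indicator (1 : (ℕ → B) → ℝ)) (iidLaw ν) :=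
      (integrable_const (1 : ℝ)).indicator hset
    have h := integral_mono (hi2.add hi3) (hi (n + 1)) hpt
    simp only [Pi.add_apply] at h
    rw [integral_add hi2 hi3, integral_add hi1 (integrable_const _), integral_sub (hi n) (hDn n),
      hDint, integral_indicator_one hset] at h
    simp only [integral_const, probReal_univ, one_smul] at h
    linarith
  have hgrow : ∀ n : ℕ, n * δ ≤ ∫ b, sojourn s (D ∘ b) n ∂iidLaw ν := by
    intro n
    induction n with
    | zero => simp [sojourn]
    | succ n ih =>
      push_cast
      linarith [hstep n]
  obtain ⟨n, hn⟩ := exists_nat_gt (M / δ)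
  rw [div_lt_iff₀ hδ0] at hn
  linarith [hgrow n, hM' n]

/-- In a queue whose mean interarrival time is at most the service time and whose interarrival
times are unbounded, the averages of the sojourn times tend to infinity. -/
theorem ae_tendsto_sum_sojourn_div_atTop (hD : Measurable D) (hD0 : ∀ x, 0 ≤ D x)
    (hDi : Integrable D ν) (hs : 0 ≤ s) (hle : ∫ x, D x ∂ν ≤ s)
    (hunb : ∀ K : ℝ, ν {x | K < D x} ≠ 0) :
    ∀ᵐ b ∂iidLaw ν, Tendsto
      (fun n : ℕ => (∑ i ∈ Finset.range n, sojourn s (D ∘ b) (i + 1)) / n) atTop atTop := by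
  filter_upwards [ae_all_iff.2 fun m => ae_tendsto_sum_shift_div (ν := ν)
    (measurable_sojourn hD s (m + 1)) (integrable_sojourn hD hD0 hs (m + 1))] with b hb
  refine tendsto_atTop.2 fun M => ?_
  -- Restarting the queue leaves `n - m` terms of mean above `2 * max M 0`. The factor `2` absorbs
  -- the ratio `n / (n - m)`, which is at most `2` once `n ≥ 2 * m`.
  obtain ⟨m, hm⟩ := exists_lt_integral_sojourn hD hD0 hDi hs hle hunb (2 * max M 0)
  have hev := (hb m).eventually (lt_mem_nhds hm)
  rw [eventually_atTop] at hev ⊢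
  obtain ⟨N, hN⟩ := hev
  refine ⟨N + m + m + 1, fun n hn => ?_⟩
  have h1 := hN (n - m) (by omega)
  have hnm : (0 : ℝ) < (n - m : ℕ) := by exact_mod_cast (by omega : 0 < n - m)
  rw [lt_div_iff₀ hnm] at h1
  have h2 : ∑ i ∈ Finset.range (n - m), sojourn s (D ∘ shift i b) (m + 1) ≤
      ∑ i ∈ Finset.range n, sojourn s (D ∘ b) (i + 1) := by
    obtain ⟨k, rfl⟩ : ∃ k, n = m + k := ⟨n - m, by omega⟩
    rw [Nat.add_sub_cancel_left, Finset.sum_range_add]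
    refine le_add_of_nonneg_of_le (Finset.sum_nonneg fun i _ => sojourn_nonneg hs _)
      (Finset.sum_le_sum fun i _ => ?_)
    rw [add_comm m i, add_assoc]
    exact sojourn_shift_le (d := D ∘ b) hs i (m + 1)
  have hn' : (0 : ℝ) < n := by exact_mod_cast (by omega : 0 < n)
  rw [le_div_iff₀ hn']
  have h3 : (n : ℝ) ≤ 2 * (n - m : ℕ) := by exact_mod_cast (by omega : n ≤ 2 * (n - m))
  have h4 : M * n ≤ max M 0 * n := mul_le_mul_of_nonneg_right (le_max_left _ _) hn'.le
  have h5 := mul_le_mul_of_nonneg_left h3 (le_max_right M 0)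
  linarith

end Queue

/-! ### The arrival process and its restart at an arrival -/

section Arrivals

/-- Infinitely many symbols arrive. -/
def ArrivesForever (a : ℕ → Bool) : Prop := ∀ n, ∃ t, n ≤ t ∧ a t = true

variable {a a' : ℕ → Bool}

lemma ArrivesForever.shift (ha : ArrivesForever a) (k : ℕ) : ArrivesForever (shift k a) := by
  intro n
  obtain ⟨t, ht, hat⟩ := ha (k + n)
  exact ⟨t - k, by omega, by rwa [shift_apply, Nat.add_sub_cancel' (by omega)]⟩

lemma arrivalTime_succ_eq {n k : ℕ} (h1 : arrivalTime a n ≤ k) (h2 : a k = true)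
    (h3 : ∀ j, arrivalTime a n ≤ j → a j = true → k ≤ j) : arrivalTime a (n + 1) = k + 1 := by
  have : IsLeast {t | arrivalTime a n ≤ t ∧ a t = true} k := ⟨⟨h1, h2⟩, fun j hj => h3 j hj.1 hj.2⟩
  simp only [arrivalTime, this.csInf_eq]

lemma ArrivesForever.exists_arrivalTime_succ (ha : ArrivesForever a) (n : ℕ) :
    ∃ k, arrivalTime a n ≤ k ∧ a k = true ∧ (∀ j, arrivalTime a n ≤ j → a j = true → k ≤ j) ∧
      arrivalTime a (n + 1) = k + 1 := by
  have hne : {t | arrivalTime a n ≤ t ∧ a t = true}.Nonempty := ha _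
  have hmem := Nat.sInf_mem hne
  exact ⟨_, hmem.1, hmem.2, fun j h1 h2 => Nat.sInf_le ⟨h1, h2⟩, rfl⟩

lemma ArrivesForever.strictMono_arrivalTime (ha : ArrivesForever a) :
    StrictMono (arrivalTime a) := by
  refine strictMono_nat_of_lt_succ fun n => ?_
  obtain ⟨k, h1, -, -, h4⟩ := ha.exists_arrivalTime_succ n
  omega

/-- Arrival times are stopping times: the pattern before the `n`-th arrival determines the first `n`
of them. -/
lemma ArrivesForever.arrivalTime_congr (ha : ArrivesForever a) {n : ℕ}
    (h : ∀ k < arrivalTime a n, a k = a' k) :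
    ∀ m ≤ n, arrivalTime a' m = arrivalTime a m := by
  intro m
  induction m with
  | zero => exact fun _ => rfl
  | succ m ih =>
    intro hm
    obtain ⟨k, h1, h2, h3, h4⟩ := ha.exists_arrivalTime_succ m
    have hk : k < arrivalTime a n := by
      have := ha.strictMono_arrivalTime.monotone hm
      omega
    have ih' := ih (by omega)
    rw [h4]
    refine arrivalTime_succ_eq (by omega) (by rw [← h k hk, h2]) fun j hj1 hj2 => ?_
    by_contra! hlt
    have := h3 j (by omega) (by rw [h j (by omega), hj2])
    omega

lemma ArrivesForever.arrivalTime_add (ha : ArrivesForever a) (n m : ℕ) :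
    arrivalTime a (n + m) =
      arrivalTime a n + arrivalTime (RealTimeCoding.shift (arrivalTime a n) a) m := by
  induction m with
  | zero => rfl
  | succ m ih =>
    obtain ⟨k, h1, h2, h3, h4⟩ := (ha.shift (arrivalTime a n)).exists_arrivalTime_succ m
    rw [h4, ← add_assoc, ← add_assoc]
    refine arrivalTime_succ_eq (by omega) h2 fun j hj1 hj2 => ?_
    have := h3 (j - arrivalTime a n) (by omega)
      (by rwa [shift_apply, Nat.add_sub_cancel' (by omega)])
    omega

/-- The sum over the first `n` symbols of the time between their arrival and that of symbol `n`. -/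
def gatherTime (a : ℕ → Bool) (n : ℕ) : ℕ :=
  ∑ k ∈ Finset.range n, (arrivalTime a n - arrivalTime a (k + 1))

lemma ArrivesForever.gatherTime_congr (ha : ArrivesForever a) {n : ℕ}
    (h : ∀ k < arrivalTime a n, a k = a' k) : gatherTime a' n = gatherTime a n := by
  have h' := ha.arrivalTime_congr h
  refine Finset.sum_congr rfl fun k hk => ?_
  rw [h' n le_rfl, h' (k + 1) (by simp at hk; omega)]

lemma measurable_sInf_nat {Z : Type*} [MeasurableSpace Z] {p : ℕ → Z → Prop}
    (hp : ∀ t, MeasurableSet {z | p t z}) : Measurable fun z => sInf {t | p t z} := by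
  refine measurable_to_countable' fun k => ?_
  -- The second set accounts for `sInf ∅ = 0`.
  have : (fun z => sInf {t | p t z}) ⁻¹' {k} =
      ({z | p k z} ∩ ⋂ j < k, {z | p j z}ᶜ) ∪ ({z | k = 0} ∩ ⋂ j, {z | p j z}ᶜ) := by
    ext z
    simp only [Set.mem_preimage, Set.mem_singleton_iff, Set.mem_union, Set.mem_inter_iff,
      Set.mem_iInter, Set.mem_compl_iff, Set.mem_ofPred_eq]
    constructor
    · rintro rfl
      rcases Set.eq_empty_or_nonempty {t | p t z} with h | h
      · right
        exact ⟨by rw [h, Nat.sInf_empty], fun j hj => by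
          have : j ∈ {t | p t z} := hj
          rw [h] at this
          exact this⟩
      · exact Or.inl ⟨Nat.sInf_mem h, fun j hj => Nat.notMem_of_lt_sInf hj⟩
    · rintro (⟨h1, h2⟩ | ⟨h1, h2⟩)
      · exact IsLeast.csInf_eq ⟨h1, fun j hj => by
          by_contra! hlt
          exact h2 j hlt hj⟩
      · rw [h1, Nat.sInf_eq_zero]
        exact Or.inr (Set.eq_empty_of_forall_notMem h2)
  rw [this]
  refine MeasurableSet.union ((hp k).inter ?_) (MeasurableSet.inter (by simp) ?_)
  · exact .iInter fun j => .iInter fun _ => (hp j).compl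
  · exact .iInter fun j => (hp j).compl

lemma measurableSet_apply_eq_true (t : ℕ) : MeasurableSet {a : ℕ → Bool | a t = true} :=
  measurableSet_eq_fun (measurable_pi_apply t) measurable_const

lemma measurable_arrivalTime (n : ℕ) : Measurable fun a => arrivalTime a n := by
  induction n with
  | zero => exact measurable_const
  | succ n ih =>
    refine (measurable_from_nat (f := fun k => k + 1)).comp (measurable_sInf_nat fun t => ?_)
    exact (measurableSet_le ih measurable_const).inter (measurableSet_apply_eq_true t)

lemma measurable_gatherTime (n : ℕ) : Measurable fun a => gatherTime a n := by
  unfold gatherTime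
  refine Finset.measurable_sum _ fun k _ => ?_
  exact (measurable_from_prod_countable_right fun _ => measurable_from_nat :
    Measurable fun v : ℕ × ℕ => v.1 - v.2).comp
    ((measurable_arrivalTime n).prodMk (measurable_arrivalTime (k + 1)))

/-- The arrival pattern that agrees with `a` before time `t` and has an arrival at each later time
step. -/
def fillAfter (t : ℕ) (a : ℕ → Bool) : ℕ → Bool := fun k => if k < t then a k else true

lemma arrivesForever_fillAfter (t : ℕ) (a : ℕ → Bool) : ArrivesForever (fillAfter t a) :=
  fun n => ⟨max n t, le_max_left _ _, if_neg (by omega)⟩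

lemma measurable_fillAfter (t : ℕ) : Measurable (fillAfter t) := by
  refine measurable_pi_lambda _ fun k => ?_
  unfold fillAfter
  split_ifs <;> fun_prop

variable (ν : Measure Bool) [IsProbabilityMeasure ν]

/-- The frequency of arrivals tends to a positive number, whereas finitely many arrivals would have
frequency zero. -/
lemma ae_arrivesForever (hν : ν {true} ≠ 0) : ∀ᵐ a ∂iidLaw ν, ArrivesForever a := by
  have hm : Measurable fun a : ℕ → Bool => if a 0 = true then (1 : ℝ) else 0 :=
    Measurable.ite (measurableSet_apply_eq_true 0) measurable_const measurable_const
  have hi : Integrable (fun a : ℕ → Bool => if a 0 = true then (1 : ℝ) else 0) (iidLaw ν) :=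
    Integrable.of_bound hm.aestronglyMeasurable 1 (ae_of_all _ fun a => by split_ifs <;> simp)
  have hpos : 0 < ∫ a : ℕ → Bool, (if a 0 = true then (1 : ℝ) else 0) ∂iidLaw ν := by
    have h1 : (fun a : ℕ → Bool => if a 0 = true then (1 : ℝ) else 0) =
        Set.indicator ((fun a : ℕ → Bool => a 0) ⁻¹' {true}) 1 := by
      funext a
      by_cases h : a 0 = true
      · rw [if_pos h, Set.indicator_of_mem (show a ∈ (fun a : ℕ → Bool => a 0) ⁻¹' {true} from h)]
        rfl
      · rw [if_neg h,
          Set.indicator_of_notMem (show a ∉ (fun a : ℕ → Bool => a 0) ⁻¹' {true} from h)]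
    rw [h1, integral_indicator_one (measurable_pi_apply 0 (measurableSet_singleton true))]
    have := (measurePreserving_eval_infinitePi (fun _ : ℕ => ν) 0).measure_preimage
      (measurableSet_singleton true).nullMeasurableSet
    refine ENNReal.toReal_pos ?_ (measure_ne_top _ _)
    rw [← this] at hν
    exact hν
  filter_upwards [ae_tendsto_sum_shift_div hm hi] with a ha
  by_contra hnot
  simp only [ArrivesForever, not_forall, not_exists, not_and] at hnot
  obtain ⟨N, hN⟩ := hnot
  have hbound : ∀ n, ∑ i ∈ Finset.range n, (if shift i a 0 = true then (1 : ℝ) else 0) ≤ N := by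
    intro n
    rw [← Finset.sum_filter]
    simp only [Finset.sum_const, nsmul_eq_mul, mul_one, Nat.cast_le]
    calc _ ≤ (Finset.range N).card := by
          refine Finset.card_le_card fun i hi => ?_
          simp only [Finset.mem_filter, Finset.mem_range, shift_apply, add_zero] at hi ⊢
          by_contra! hle
          exact hN i hle hi.2
      _ = N := Finset.card_range N
  have hlim : Tendsto (fun n : ℕ => (N : ℝ) / n) atTop (𝓝 0) :=
    tendsto_const_nhds.div_atTop tendsto_natCast_atTop_atTop
  exact absurd (le_of_tendsto_of_tendsto' ha hlim fun n =>
    div_le_div_of_nonneg_right (hbound n) n.cast_nonneg) (not_le.2 hpos)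

/-- The strong Markov property at the `n`-th arrival, one value at a time. Because of the default
value of `sInf ∅`, the event need not be determined by the first `t` steps when arrivals cease. Its
preimage under `fillAfter t` is so determined, and differs from it by a null set. -/
lemma map_shift_restrict_arrivalTime (hν : ν {true} ≠ 0) (n t j : ℕ) :
    ((iidLaw ν).restrict {a | arrivalTime a n = t ∧ gatherTime a n = j}).map (shift t) =
      iidLaw ν {a | arrivalTime a n = t ∧ gatherTime a n = j} • iidLaw ν := by
  set C : Set (ℕ → Bool) := {a | arrivalTime a n = t ∧ gatherTime a n = j} with hC
  have hCm : MeasurableSet C :=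
    (measurable_arrivalTime n (measurableSet_singleton t)).inter
      (measurable_gatherTime n (measurableSet_singleton j))
  have hdet : DeterminedBy t (fillAfter t ⁻¹' C) := by
    intro z z' h hz
    have : fillAfter t z' = fillAfter t z := by
      ext k
      simp only [fillAfter]
      split_ifs with hk
      · rw [h k hk]
      · rfl
    rwa [Set.mem_preimage, this]
  have hae : C =ᵐ[iidLaw ν] fillAfter t ⁻¹' C := by
    filter_upwards [ae_arrivesForever ν hν] with a ha
    refine propext ⟨fun h => ?_, fun h => ?_⟩
    · have heq : ∀ k < arrivalTime a n, a k = fillAfter t a k := fun k hk => by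
        rw [show arrivalTime a n = t from h.1] at hk
        simp [fillAfter, hk]
      exact ⟨(ha.arrivalTime_congr heq n le_rfl).trans h.1, (ha.gatherTime_congr heq).trans h.2⟩
    · have hf := arrivesForever_fillAfter t a
      have h' : fillAfter t a ∈ C := h
      have heq : ∀ k < arrivalTime (fillAfter t a) n, fillAfter t a k = a k := fun k hk => by
        rw [h'.1] at hk
        simp [fillAfter, hk]
      exact ⟨(hf.arrivalTime_congr heq n le_rfl).trans h'.1, (hf.gatherTime_congr heq).trans h'.2⟩
  rw [Measure.restrict_congr_set hae, measure_congr hae]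
  exact map_shift_restrict ν (measurable_fillAfter t hCm) hdet

end Arrivals

/-! ### Shifts by a random amount and the i.i.d. sequences they generate -/

section RandomShift

variable {Z ι : Type*} [MeasurableSpace Z] [MeasurableSpace ι] [Countable ι]
  [MeasurableSingletonClass ι] {P : Measure Z}
  {σ : Z → ι} {θ : ι → Z → Z}

lemma measurable_randomShift (hσ : Measurable σ) (hθ : ∀ i, Measurable (θ i)) :
    Measurable fun z => θ (σ z) z :=
  (measurable_from_prod_countable_right hθ : Measurable fun v : ι × Z => θ v.1 v.2).comp
    (hσ.prodMk measurable_id)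

/-- If `θ i` maps the law conditioned on `σ = i` to the original law, then `θ (σ z) z` is
independent of `σ z` and has the original law. -/
lemma measure_inter_preimage_randomShift (hσ : Measurable σ) (hθ : ∀ i, Measurable (θ i))
    (h : ∀ i, (P.restrict (σ ⁻¹' {i})).map (θ i) = P (σ ⁻¹' {i}) • P)
    {S : Set ι} {B : Set Z} (hB : MeasurableSet B) :
    P (σ ⁻¹' S ∩ (fun z => θ (σ z) z) ⁻¹' B) = P (σ ⁻¹' S) * P B := by
  have hτ := measurable_randomShift hσ hθ
  have hS : MeasurableSet S := S.to_countable.measurableSet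
  -- For fixed `B`, both sides are measures on a countable type, so singletons `S` suffice.
  have key : (P.restrict ((fun z => θ (σ z) z) ⁻¹' B)).map σ = P B • P.map σ := by
    refine Measure.ext_of_singleton fun i => ?_
    rw [Measure.map_apply hσ (measurableSet_singleton i),
      Measure.restrict_apply (hσ (measurableSet_singleton i)), Measure.smul_apply,
      Measure.map_apply hσ (measurableSet_singleton i), smul_eq_mul, mul_comm]
    have h1 : σ ⁻¹' {i} ∩ (fun z => θ (σ z) z) ⁻¹' B = θ i ⁻¹' B ∩ σ ⁻¹' {i} := by
      ext z
      simp only [Set.mem_inter_iff, Set.mem_preimage, Set.mem_singleton_iff]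
      constructor
      · rintro ⟨rfl, h⟩; exact ⟨h, rfl⟩
      · rintro ⟨h, rfl⟩; exact ⟨rfl, h⟩
    rw [h1, ← Measure.restrict_apply (hθ i hB), ← Measure.map_apply (hθ i) hB, h i]
    simp
  have := congrArg (fun m => m S) key
  simp only [Measure.smul_apply, smul_eq_mul] at this
  rwa [Measure.map_apply hσ hS, Measure.restrict_apply (hσ hS), Measure.map_apply hσ hS,
    mul_comm] at this

lemma measurePreserving_randomShift [IsProbabilityMeasure P] (hσ : Measurable σ)
    (hθ : ∀ i, Measurable (θ i))
    (h : ∀ i, (P.restrict (σ ⁻¹' {i})).map (θ i) = P (σ ⁻¹' {i}) • P) :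
    MeasurePreserving (fun z => θ (σ z) z) P P := by
  refine ⟨measurable_randomShift hσ hθ, ?_⟩
  ext B hB
  rw [Measure.map_apply (measurable_randomShift hσ hθ) hB]
  simpa using measure_inter_preimage_randomShift hσ hθ h (S := Set.univ) hB

/-- If `τ z` is independent of `β z` and distributed like `z`, then the variables `β (τ^[i] z)` are
independent and identically distributed. -/
lemma map_iterate_eq_iidLaw [IsProbabilityMeasure P] {M : Type*} [MeasurableSpace M] {β : Z → M} {τ : Z → Z}
    (hβ : Measurable β) (hτ : Measurable τ)
    (h : ∀ (S : Set M) (B : Set Z), MeasurableSet S → MeasurableSet B →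
      P (β ⁻¹' S ∩ τ ⁻¹' B) = P (β ⁻¹' S) * P B)
    {ν : Measure M} [IsProbabilityMeasure ν] (hν : P.map β = ν) :
    P.map (fun z i => β (τ^[i] z)) = iidLaw ν := by
  have hmeas : ∀ i, Measurable fun z => β (τ^[i] z) := fun i => hβ.comp (hτ.iterate i)
  have key : ∀ (n : ℕ) (t : ℕ → Set M), (∀ i, MeasurableSet (t i)) →
      P (⋂ i ∈ Finset.range n, (fun z => β (τ^[i] z)) ⁻¹' t i) =
        ∏ i ∈ Finset.range n, ν (t i) := by
    intro n
    induction n with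
    | zero => intro t _; simp
    | succ n ih =>
      intro t ht
      have hset : (⋂ i ∈ Finset.range (n + 1), (fun z => β (τ^[i] z)) ⁻¹' t i) =
          β ⁻¹' t 0 ∩ τ ⁻¹' (⋂ i ∈ Finset.range n, (fun z => β (τ^[i] z)) ⁻¹' t (i + 1)) := by
        ext z
        simp only [Set.mem_iInter, Set.mem_preimage, Finset.mem_range, Set.mem_inter_iff]
        constructor
        · exact fun hz => ⟨hz 0 (by omega), fun i hi => hz (i + 1) (by omega)⟩
        · rintro ⟨h0, h1⟩ i hi
          cases i with
          | zero => exact h0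
          | succ i => exact h1 i (by omega)
      rw [hset, h _ _ (ht 0) (Finset.measurableSet_biInter _ fun i _ => hmeas i (ht _)),
        ih (fun i => t (i + 1)) (fun i => ht _), Finset.prod_range_succ', mul_comm,
        ← Measure.map_apply hβ (ht 0), hν]
  refine Measure.eq_infinitePi _ fun s t ht => ?_
  rw [Measure.map_apply (measurable_pi_lambda _ hmeas)
    (MeasurableSet.pi s.countable_toSet fun i _ => ht i)]
  classical
  -- An arbitrary finite box is completed to an initial segment of indices by factors `Set.univ`.
  have h1 := key (s.sup id + 1) (fun i => if i ∈ s then t i else Set.univ)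
    (fun i => by split_ifs; exacts [ht i, .univ])
  have hsub : s ⊆ Finset.range (s.sup id + 1) := fun i hi => by
    simpa [Nat.lt_succ_iff] using Finset.le_sup (f := id) hi
  rw [← Finset.prod_subset hsub (fun i _ hi => by rw [if_neg hi, measure_univ])] at h1
  rw [Finset.prod_congr rfl fun i hi => by rw [if_pos hi]] at h1
  rw [← h1]
  congr 1
  ext z
  simp only [Set.mem_preimage, Set.mem_pi, Finset.mem_coe, Set.mem_iInter]
  constructor
  · intro hz i _
    split_ifs with hi
    exacts [hz i hi, trivial]
  · intro hz i hi
    have := hz i (hsub hi)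
    rwa [if_pos hi] at this

end RandomShift

/-! ### Mean arrival times -/

section MeanArrival

variable (ν : Measure Bool) [IsProbabilityMeasure ν]

lemma lt_arrivalTime_one_iff {a : ℕ → Bool} (ha : ArrivesForever a) (t : ℕ) :
    t < arrivalTime a 1 ↔ ∀ k < t, a k = false := by
  obtain ⟨k, -, h2, h3, h4⟩ := ha.exists_arrivalTime_succ 0
  rw [zero_add] at h4
  rw [h4]
  constructor
  · intro h j hj
    by_contra hne
    have := h3 j (Nat.zero_le _) (by simpa using hne)
    omega
  · intro h
    by_contra! hle
    rw [h k (by omega)] at h2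
    exact Bool.false_ne_true h2

lemma measure_forall_lt_eq_false (t : ℕ) :
    iidLaw ν {a | ∀ k < t, a k = false} = ν {false} ^ t := by
  have : {a : ℕ → Bool | ∀ k < t, a k = false} =
      Set.pi (Finset.range t : Finset ℕ) fun _ => {false} := by
    ext a; simp [Set.mem_pi]
  rw [this, Measure.infinitePi_pi _ (fun _ _ => measurableSet_singleton _)]
  simp

/-- The mean is the sum of the tail probabilities, a geometric series with ratio `ν {false}`. -/
lemma lintegral_arrivalTime_one (hν : ν {true} ≠ 0) :
    ∫⁻ a, (arrivalTime a 1 : ENNReal) ∂iidLaw ν = (1 - ν {false})⁻¹ := by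
  have h : ∀ a : ℕ → Bool, (arrivalTime a 1 : ENNReal) =
      ∑' t : ℕ, {a : ℕ → Bool | t < arrivalTime a 1}.indicator 1 a := by
    intro a
    rw [tsum_eq_sum (s := Finset.range (arrivalTime a 1))]
    · rw [Finset.sum_congr rfl (g := fun _ => (1 : ENNReal))]
      · simp
      · intro t ht
        rw [Set.indicator_of_mem (by simpa using ht)]
        rfl
    · intro t ht
      rw [Set.indicator_of_notMem (by simpa using ht)]
  have hm : ∀ t : ℕ, MeasurableSet {a : ℕ → Bool | t < arrivalTime a 1} := fun t =>
    measurableSet_lt measurable_const (measurable_arrivalTime 1)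
  simp only [h]
  rw [lintegral_tsum fun t => (measurable_one.indicator (hm t)).aemeasurable,
    ← ENNReal.tsum_geometric]
  congr 1
  ext t
  rw [lintegral_indicator_one (hm t), ← measure_forall_lt_eq_false]
  refine measure_congr ?_
  filter_upwards [ae_arrivesForever ν hν] with a ha
  exact propext (lt_arrivalTime_one_iff ha t)

/-- By the restart at the `n`-th arrival, each further gap has the law of the first arrival time. -/
lemma lintegral_arrivalTime (hν : ν {true} ≠ 0) (n : ℕ) :
    ∫⁻ a, (arrivalTime a n : ENNReal) ∂iidLaw ν = n * (1 - ν {false})⁻¹ := by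
  have hcast : Measurable fun k : ℕ => (k : ENNReal) := measurable_from_nat
  induction n with
  | zero => simp [arrivalTime]
  | succ n ih =>
    have hmp : MeasurePreserving (fun a => shift (arrivalTime a n) a) (iidLaw ν) (iidLaw ν) := by
      have := measurePreserving_randomShift (P := iidLaw ν)
        (σ := fun a => (arrivalTime a n, gatherTime a n)) (θ := fun v => shift v.1)
        ((measurable_arrivalTime n).prodMk (measurable_gatherTime n))
        (fun v => measurable_shift v.1) (fun ⟨t, j⟩ => by
          have := map_shift_restrict_arrivalTime ν hν n t j
          simpa only [Set.preimage, Set.mem_singleton_iff, Prod.mk.injEq] using this)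
      exact this
    have h1 : ∫⁻ a, (arrivalTime a (n + 1) : ENNReal) ∂iidLaw ν =
        ∫⁻ a, ((arrivalTime a n : ENNReal) + arrivalTime (shift (arrivalTime a n) a) 1)
          ∂iidLaw ν := by
      refine lintegral_congr_ae ?_
      filter_upwards [ae_arrivesForever ν hν] with a ha
      rw [ha.arrivalTime_add n 1, Nat.cast_add]
    have h2 : ∫⁻ a, (arrivalTime (shift (arrivalTime a n) a) 1 : ENNReal) ∂iidLaw ν =
        ∫⁻ a, (arrivalTime a 1 : ENNReal) ∂iidLaw ν :=
      hmp.lintegral_comp (hcast.comp (measurable_arrivalTime 1))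
    rw [h1, lintegral_add_left
      (show Measurable fun a => (arrivalTime a n : ENNReal) from
        hcast.comp (measurable_arrivalTime n)), ih, h2, lintegral_arrivalTime_one ν hν]
    push_cast
    ring

end MeanArrival

lemma measure_true_ne_zero {νa : Measure Bool} {q : ℝ} (hq : 0 < q) (hνa : νa {true} = ENNReal.ofReal q) :
    νa {true} ≠ 0 := by
  rw [hνa]
  exact (ENNReal.ofReal_pos.2 hq).ne'

/-! ### Parsing into blocks and independence of the blocks -/

section Blocks

variable {𝒳 : Type*} (c : V2FCode 𝒳)

lemma V2FCode.finite_dict : c.dict.Finite :=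
  Set.Finite.of_injOn (Set.mapsTo_univ c.enc c.dict) c.enc_injOn Set.finite_univ

lemma V2FCode.ncard_dict_le : c.dict.ncard ≤ 2 ^ c.len := by
  have := Set.ncard_le_ncard_of_injOn c.enc (t := Set.univ) (fun _ _ => Set.mem_univ _) c.enc_injOn
  simpa [Set.ncard_univ] using this

lemma V2FCode.blockLen_mem (x : ℕ → 𝒳) : (List.range (c.blockLen x)).map x ∈ c.dict :=
  Nat.sInf_mem (c.complete x)

lemma V2FCode.blockLen_eq_of_mem {x : ℕ → 𝒳} {n : ℕ} (h : (List.range n).map x ∈ c.dict) :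
    c.blockLen x = n := by
  have hle : c.blockLen x ≤ n := Nat.sInf_le h
  have hpre : (List.range (c.blockLen x)).map x <+: (List.range n).map x := by
    obtain ⟨k, rfl⟩ := Nat.exists_eq_add_of_le hle
    rw [List.range_add, List.map_append]
    exact List.prefix_append _ _
  have := congrArg List.length (c.prefix_free _ (c.blockLen_mem x) _ h hpre)
  simpa using this

lemma V2FCode.blockLen_eq_iff {x : ℕ → 𝒳} {n : ℕ} :
    c.blockLen x = n ↔ (List.range n).map x ∈ c.dict :=
  ⟨fun h => h ▸ c.blockLen_mem x, c.blockLen_eq_of_mem⟩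

lemma V2FCode.blockLen_pos (x : ℕ → 𝒳) : 0 < c.blockLen x := by
  by_contra! h
  have := c.blockLen_mem x
  rw [Nat.le_zero.1 h] at this
  exact c.nil_notMem this

/-- The dictionary embeds into a finite set of codewords. The resulting bound makes the block length
integrable and an admissible weight in the stable queue. -/
lemma V2FCode.exists_blockLen_le : ∃ M, ∀ x : ℕ → 𝒳, c.blockLen x ≤ M := by
  obtain ⟨M, hM⟩ := (c.finite_dict.image List.length).bddAbove
  exact ⟨M, fun x => hM ⟨_, c.blockLen_mem x, by simp⟩⟩

lemma V2FCode.lintegral_blockLen_ne_top [MeasurableSpace 𝒳] (νx : Measure 𝒳)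
    [IsProbabilityMeasure νx] :
    ∫⁻ x, (c.blockLen x : ENNReal) ∂iidLaw νx ≠ ⊤ := by
  obtain ⟨M, hM⟩ := c.exists_blockLen_le
  refine ne_top_of_le_ne_top (ENNReal.natCast_ne_top M) ?_
  calc ∫⁻ x, (c.blockLen x : ENNReal) ∂iidLaw νx ≤ ∫⁻ _, (M : ENNReal) ∂iidLaw νx :=
        lintegral_mono fun x => Nat.cast_le.2 (hM x)
    _ = M := by simp

lemma map_range_congr {x x' : ℕ → 𝒳} {n : ℕ} (h : ∀ k < n, x k = x' k) :
    (List.range n).map x = (List.range n).map x' :=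
  List.map_congr_left fun k hk => h k (List.mem_range.1 hk)

lemma V2FCode.determinedBy_blockLen (n : ℕ) : DeterminedBy n {x : ℕ → 𝒳 | c.blockLen x = n} := by
  intro x x' h hx
  simp only [Set.mem_ofPred_eq, c.blockLen_eq_iff] at hx ⊢
  rwa [← map_range_congr h]

section

variable [Fintype 𝒳] [MeasurableSpace 𝒳] [MeasurableSingletonClass 𝒳]

lemma measurableSet_map_range (n : ℕ) (S : Set (List 𝒳)) :
    MeasurableSet {x : ℕ → 𝒳 | (List.range n).map x ∈ S} := by
  have hm : Measurable fun (x : ℕ → 𝒳) (i : Fin n) => x i :=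
    measurable_pi_lambda _ fun i => measurable_pi_apply _
  have hS : MeasurableSet {w : Fin n → 𝒳 | List.ofFn w ∈ S} :=
    (Set.toFinite _).measurableSet
  convert hm hS using 1
  ext x
  have : (List.range n).map x = List.ofFn fun i : Fin n => x i := by
    apply List.ext_getElem <;> simp
  simp only [Set.mem_ofPred_eq, Set.mem_preimage, this]

lemma V2FCode.measurable_blockLen : Measurable (c.blockLen : (ℕ → 𝒳) → ℕ) :=
  measurable_sInf_nat fun n => measurableSet_map_range n c.dict

end

/-- The length of the first block, the arrival time of its last symbol, and the sum over its
symbols of the time between their arrival and that of the last symbol. -/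
def V2FCode.blockData (z : (ℕ → 𝒳) × (ℕ → Bool)) : ℕ × ℕ × ℕ :=
  (c.blockLen z.1, arrivalTime z.2 (c.blockLen z.1), gatherTime z.2 (c.blockLen z.1))

/-- Removal of the first block. -/
def V2FCode.blockShift (z : (ℕ → 𝒳) × (ℕ → Bool)) : (ℕ → 𝒳) × (ℕ → Bool) :=
  (shift (c.blockLen z.1) z.1, shift (arrivalTime z.2 (c.blockLen z.1)) z.2)

section

variable [Fintype 𝒳] [MeasurableSpace 𝒳] [MeasurableSingletonClass 𝒳]

lemma V2FCode.measurable_blockData : Measurable c.blockData := by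
  have hl : Measurable fun z : (ℕ → 𝒳) × (ℕ → Bool) => c.blockLen z.1 :=
    c.measurable_blockLen.comp measurable_fst
  have hu : ∀ {f : ℕ → (ℕ → Bool) → ℕ}, (∀ n, Measurable (f n)) →
      Measurable fun z : (ℕ → 𝒳) × (ℕ → Bool) => f (c.blockLen z.1) z.2 := fun {f} hf =>
    (measurable_from_prod_countable_right hf :
      Measurable fun v : ℕ × (ℕ → Bool) => f v.1 v.2).comp (hl.prodMk measurable_snd)
  exact hl.prodMk ((hu (f := fun n a => arrivalTime a n) measurable_arrivalTime).prodMk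
    (hu (f := fun n a => gatherTime a n) measurable_gatherTime))

variable (νx : Measure 𝒳) [IsProbabilityMeasure νx] (νa : Measure Bool) [IsProbabilityMeasure νa]

/-- The law of the data of a block. -/
def V2FCode.blockLaw : Measure (ℕ × ℕ × ℕ) :=
  ((iidLaw νx).prod (iidLaw νa)).map c.blockData

instance V2FCode.isProbabilityMeasure_blockLaw : IsProbabilityMeasure (c.blockLaw νx νa) :=
  Measure.isProbabilityMeasure_map c.measurable_blockData.aemeasurable

/-- Once the block length is fixed, the event is a rectangle, with one condition on the symbols and
one on the arrivals. Both factors restart afresh, and the product law splits accordingly. -/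
lemma V2FCode.map_shift_restrict_blockData (hν : νa {true} ≠ 0) (i : ℕ × ℕ × ℕ) :
    (((iidLaw νx).prod (iidLaw νa)).restrict (c.blockData ⁻¹' {i})).map
        (Prod.map (shift i.1) (shift i.2.1)) =
      ((iidLaw νx).prod (iidLaw νa)) (c.blockData ⁻¹' {i}) •
        (iidLaw νx).prod (iidLaw νa) := by
  obtain ⟨n, t, j⟩ := i
  have hset : c.blockData ⁻¹' {(n, t, j)} = {x : ℕ → 𝒳 | c.blockLen x = n} ×ˢ
      {a : ℕ → Bool | arrivalTime a n = t ∧ gatherTime a n = j} := by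
    ext ⟨x, a⟩
    simp only [V2FCode.blockData, Set.mem_preimage, Set.mem_singleton_iff, Prod.mk.injEq,
      Set.mem_prod, Set.mem_ofPred_eq]
    constructor
    · rintro ⟨rfl, h1, h2⟩; exact ⟨rfl, h1, h2⟩
    · rintro ⟨rfl, h1, h2⟩; exact ⟨rfl, h1, h2⟩
  rw [hset, ← Measure.prod_restrict, ← Measure.map_prod_map _ _ (measurable_shift n)
    (measurable_shift t), map_shift_restrict_arrivalTime νa hν,
    map_shift_restrict νx (measurableSet_eq_fun c.measurable_blockLen measurable_const)
      (c.determinedBy_blockLen n), Measure.prod_prod, Measure.prod_smul_left,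
    Measure.prod_smul_right, smul_smul]

lemma V2FCode.measurable_blockShift : Measurable c.blockShift :=
  measurable_randomShift (θ := fun i : ℕ × ℕ × ℕ => (Prod.map (shift i.1) (shift i.2.1) :
      (ℕ → 𝒳) × (ℕ → Bool) → (ℕ → 𝒳) × (ℕ → Bool))) c.measurable_blockData
    fun _ => (measurable_shift _).prodMap (measurable_shift _)

/-- The data of the successive blocks are independent and identically distributed. -/
theorem V2FCode.map_blockData_iterate (hν : νa {true} ≠ 0) :
    ((iidLaw νx).prod (iidLaw νa)).map (fun z i => c.blockData (c.blockShift^[i] z)) =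
      iidLaw (c.blockLaw νx νa) := by
  have hθ : ∀ i : ℕ × ℕ × ℕ, Measurable (Prod.map (shift i.1) (shift i.2.1) :
      (ℕ → 𝒳) × (ℕ → Bool) → (ℕ → 𝒳) × (ℕ → Bool)) :=
    fun i => (measurable_shift _).prodMap (measurable_shift _)
  exact map_iterate_eq_iidLaw c.measurable_blockData c.measurable_blockShift
    (fun S B _ hB => measure_inter_preimage_randomShift c.measurable_blockData hθ
      (c.map_shift_restrict_blockData νx νa hν) hB) rfl

lemma V2FCode.measurable_blockData_iterate :
    Measurable fun z i => c.blockData (c.blockShift^[i] z) :=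
  measurable_pi_lambda _ fun i => c.measurable_blockData.comp (c.measurable_blockShift.iterate i)

/-- The mean length of a block. -/
def V2FCode.meanLen : ℝ := ∫ x, (c.blockLen x : ℝ) ∂iidLaw νx

/-- The time between the arrivals of the last symbols of the previous block and of this block. -/
def interarrival (v : ℕ × ℕ × ℕ) : ℝ := v.2.1

lemma measurable_interarrival : Measurable interarrival := by
  unfold interarrival
  exact (measurable_from_nat (f := fun n : ℕ => (n : ℝ))).comp (measurable_fst.comp measurable_snd)

lemma interarrival_nonneg (v : ℕ × ℕ × ℕ) : 0 ≤ interarrival v := Nat.cast_nonneg _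

lemma V2FCode.measurable_blockLen_ennreal :
    Measurable fun x : ℕ → 𝒳 => (c.blockLen x : ENNReal) :=
  (measurable_from_nat (f := fun k : ℕ => (k : ENNReal))).comp c.measurable_blockLen

lemma V2FCode.measurable_arrivalTime_blockLen :
    Measurable fun z : (ℕ → 𝒳) × (ℕ → Bool) => (arrivalTime z.2 (c.blockLen z.1) : ENNReal) :=
  (measurable_from_nat (f := fun k : ℕ => (k : ENNReal))).comp
    (measurable_fst.comp (measurable_snd.comp c.measurable_blockData))

/-- Wald's identity by Fubini: the block length is a function of the symbols, which are independent
of the arrivals. -/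
lemma V2FCode.lintegral_arrivalTime_blockLen (hν : νa {true} ≠ 0) :
    ∫⁻ z, (arrivalTime z.2 (c.blockLen z.1) : ENNReal) ∂((iidLaw νx).prod (iidLaw νa)) =
      (∫⁻ x, (c.blockLen x : ENNReal) ∂iidLaw νx) * (1 - νa {false})⁻¹ := by
  have hm := c.measurable_arrivalTime_blockLen
  rw [lintegral_prod _ hm.aemeasurable]
  simp only [lintegral_arrivalTime νa hν]
  rw [lintegral_mul_const _ c.measurable_blockLen_ennreal]

lemma V2FCode.toReal_lintegral_blockLen :
    (∫⁻ x, (c.blockLen x : ENNReal) ∂iidLaw νx).toReal = c.meanLen νx := by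
  rw [← integral_toReal c.measurable_blockLen_ennreal.aemeasurable
    (ae_of_all _ fun x => ENNReal.natCast_lt_top _)]
  simp [V2FCode.meanLen]

variable {νa}

lemma one_sub_measure_false {q : ℝ} (hνa : νa {true} = ENNReal.ofReal q) :
    1 - νa {false} = ENNReal.ofReal q := by
  rw [← hνa, ← prob_compl_eq_one_sub (measurableSet_singleton _)]
  congr 1
  ext b
  simp

lemma V2FCode.integrable_interarrival {q : ℝ} (hq : 0 < q)
    (hνa : νa {true} = ENNReal.ofReal q) :
    Integrable interarrival (c.blockLaw νx νa) := by
  have hcast : Measurable fun k : ℕ => (k : ENNReal) := measurable_from_nat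
  rw [V2FCode.blockLaw, integrable_map_measure measurable_interarrival.aestronglyMeasurable
    c.measurable_blockData.aemeasurable]
  have hm : Measurable fun z : (ℕ → 𝒳) × (ℕ → Bool) =>
      (arrivalTime z.2 (c.blockLen z.1) : ENNReal) :=
    hcast.comp (measurable_fst.comp (measurable_snd.comp c.measurable_blockData))
  have := integrable_toReal_of_lintegral_ne_top (μ := (iidLaw νx).prod (iidLaw νa)) hm.aemeasurable
    (by
      rw [c.lintegral_arrivalTime_blockLen νx νa (measure_true_ne_zero hq hνa),
        one_sub_measure_false hνa]
      exact ENNReal.mul_ne_top (c.lintegral_blockLen_ne_top νx)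
        (ENNReal.inv_ne_top.2 (ENNReal.ofReal_pos.2 hq).ne'))
  exact this.congr (ae_of_all _ fun z => by simp [interarrival, V2FCode.blockData])

lemma V2FCode.integral_interarrival {q : ℝ} (hq : 0 < q)
    (hνa : νa {true} = ENNReal.ofReal q) :
    ∫ v, interarrival v ∂c.blockLaw νx νa = c.meanLen νx / q := by
  have hm := c.measurable_arrivalTime_blockLen
  have h := integral_toReal (μ := (iidLaw νx).prod (iidLaw νa)) hm.aemeasurable
    (ae_of_all _ fun z => ENNReal.natCast_lt_top _)
  rw [c.lintegral_arrivalTime_blockLen νx νa (measure_true_ne_zero hq hνa),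
    one_sub_measure_false hνa, ENNReal.toReal_mul, c.toReal_lintegral_blockLen,
    ENNReal.toReal_inv, ENNReal.toReal_ofReal hq.le, ← div_eq_mul_inv] at h
  rw [← h, V2FCode.blockLaw, integral_map c.measurable_blockData.aemeasurable
    measurable_interarrival.aestronglyMeasurable]
  simp [interarrival, V2FCode.blockData]

/-- This is where `q < 1` enters: with positive probability nothing arrives in the first `k` steps.
-/
lemma V2FCode.measure_lt_interarrival_ne_zero {q : ℝ} (hq : 0 < q) (hq1 : q < 1)
    (hνa : νa {true} = ENNReal.ofReal q) (K : ℝ) :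
    c.blockLaw νx νa {v | K < interarrival v} ≠ 0 := by
  obtain ⟨k, hk⟩ := exists_nat_ge K
  have hfalse : νa {false} ≠ 0 := fun h0 => by
    have := one_sub_measure_false hνa
    rw [h0, tsub_zero] at this
    have h1 : ENNReal.ofReal q < 1 := ENNReal.ofReal_lt_one.2 hq1
    exact h1.ne this.symm
  have hpos : ((iidLaw νx).prod (iidLaw νa)) (Set.univ ×ˢ {a | ∀ j < k, a j = false}) ≠ 0 := by
    rw [Measure.prod_prod, measure_forall_lt_eq_false]
    simpa using pow_ne_zero k hfalse
  rw [V2FCode.blockLaw, Measure.map_apply c.measurable_blockData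
    (measurableSet_lt measurable_const measurable_interarrival)]
  refine fun h0 => hpos (measure_mono_null_ae ?_ h0)
  have hgood : ∀ᵐ z ∂((iidLaw νx).prod (iidLaw νa)), ArrivesForever z.2 :=
    Measure.quasiMeasurePreserving_snd.ae (ae_arrivesForever νa (measure_true_ne_zero hq hνa))
  filter_upwards [hgood] with z hz hzk
  have h1 : k < arrivalTime z.2 1 := (lt_arrivalTime_one_iff hz k).2 hzk.2
  have h2 : arrivalTime z.2 1 ≤ arrivalTime z.2 (c.blockLen z.1) :=
    hz.strictMono_arrivalTime.monotone (c.blockLen_pos z.1)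
  change K < ((arrivalTime z.2 (c.blockLen z.1) : ℕ) : ℝ)
  refine hk.trans_lt ?_
  exact_mod_cast h1.trans_le h2

end

/-! ### Decoding times, ages and delays as sojourn times -/

section Deterministic

variable (r : ℝ) (x : ℕ → 𝒳) {a : ℕ → Bool}

lemma V2FCode.blockShift_iterate (ha : ArrivesForever a) (i : ℕ) :
    c.blockShift^[i] (x, a) =
      (shift (c.blockEnd x i) x, shift (arrivalTime a (c.blockEnd x i)) a) := by
  induction i with
  | zero => simp [V2FCode.blockEnd, arrivalTime]
  | succ i ih =>
    rw [Function.iterate_succ_apply', ih, V2FCode.blockShift, shift_shift, shift_shift,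
      ← ha.arrivalTime_add]
    rfl

lemma V2FCode.blockEnd_succ (ha : ArrivesForever a) (i : ℕ) :
    c.blockEnd x (i + 1) = c.blockEnd x i + (c.blockData (c.blockShift^[i] (x, a))).1 := by
  rw [c.blockShift_iterate x ha]
  rfl

lemma V2FCode.arrivalTime_blockEnd_succ (ha : ArrivesForever a) (i : ℕ) :
    (arrivalTime a (c.blockEnd x (i + 1)) : ℝ) = arrivalTime a (c.blockEnd x i) +
      interarrival (c.blockData (c.blockShift^[i] (x, a))) := by
  rw [c.blockEnd_succ x ha, ha.arrivalTime_add, c.blockShift_iterate x ha, Nat.cast_add]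
  rfl

/-- Measured from the completion of the block, the decoding recursion is Lindley's, since `max (A +
D) (A + V) = A + D + max 0 (V - D)`. -/
lemma V2FCode.decodeTime_eq (ha : ArrivesForever a) (i : ℕ) :
    decodeTime c r x a i = arrivalTime a (c.blockEnd x i) + sojourn (c.len / r)
      (interarrival ∘ fun i => c.blockData (c.blockShift^[i] (x, a))) i := by
  induction i with
  | zero => simp [decodeTime, V2FCode.blockEnd, arrivalTime, sojourn]
  | succ i ih =>
    rw [decodeTime, ih, c.arrivalTime_blockEnd_succ x ha, sojourn, ← add_assoc]
    congr 1
    rw [← max_add_add_left]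
    simp only [Function.comp]
    rw [max_comm, max_comm (_ + _ + 0)]
    have : ∀ A V D : ℝ, max (A + V) (A + D) = max (A + D + (V - D)) (A + D + 0) := by
      intro A V D
      congr 1 <;> ring
    exact this _ _ _

lemma V2FCode.peakAoI_eq (ha : ArrivesForever a) (i : ℕ) :
    peakAoI c r x a (i + 1) = interarrival (c.blockData (c.blockShift^[i] (x, a))) +
      sojourn (c.len / r) (interarrival ∘ fun i => c.blockData (c.blockShift^[i] (x, a)))
        (i + 1) := by
  rw [peakAoI, c.decodeTime_eq r x ha, c.arrivalTime_blockEnd_succ x ha, Nat.add_sub_cancel]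
  ring

lemma V2FCode.strictMono_blockEnd : StrictMono (c.blockEnd x) :=
  strictMono_nat_of_lt_succ fun _ => Nat.lt_add_of_pos_right (c.blockLen_pos _)

lemma V2FCode.blockOf_eq {i n : ℕ} (h1 : c.blockEnd x i < n) (h2 : n ≤ c.blockEnd x (i + 1)) :
    c.blockOf x n = i + 1 := by
  refine IsLeast.csInf_eq ⟨h2, fun j hj => ?_⟩
  by_contra! hlt
  have := (c.strictMono_blockEnd x).monotone (Nat.lt_succ_iff.1 hlt)
  have hj' : n ≤ c.blockEnd x j := hj
  omega

/-- A symbol first waits for the end of its block and then for the sojourn time of the block, which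
is common to all symbols of the block. -/
lemma V2FCode.sum_delay_block (ha : ArrivesForever a) (i : ℕ) :
    ∑ k ∈ Finset.range (c.blockData (c.blockShift^[i] (x, a))).1,
      delay c r x a (c.blockEnd x i + k + 1) =
    (c.blockData (c.blockShift^[i] (x, a))).1 * sojourn (c.len / r)
      (interarrival ∘ fun i => c.blockData (c.blockShift^[i] (x, a))) (i + 1) +
    (c.blockData (c.blockShift^[i] (x, a))).2.2 := by
  have hg := ha.shift (arrivalTime a (c.blockEnd x i))
  set V := sojourn (c.len / r)
    (interarrival ∘ fun i => c.blockData (c.blockShift^[i] (x, a))) (i + 1) with hV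
  set L := (c.blockData (c.blockShift^[i] (x, a))).1 with hL
  have hbe := c.blockEnd_succ x ha i
  have hdel : ∀ k ∈ Finset.range L, delay c r x a (c.blockEnd x i + k + 1) = V +
      ((arrivalTime (shift (arrivalTime a (c.blockEnd x i)) a) L -
        arrivalTime (shift (arrivalTime a (c.blockEnd x i)) a) (k + 1) : ℕ) : ℝ) := by
    intro k hk
    rw [Finset.mem_range] at hk
    rw [delay, c.blockOf_eq x (i := i) (by omega) (by omega), c.decodeTime_eq r x ha, hbe,
      ha.arrivalTime_add, add_assoc (c.blockEnd x i), ha.arrivalTime_add _ (k + 1),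
      Nat.cast_sub (hg.strictMono_arrivalTime.monotone (by omega : k + 1 ≤ L))]
    push_cast
    ring
  rw [Finset.sum_congr rfl hdel, Finset.sum_add_distrib, Finset.sum_const, Finset.card_range,
    nsmul_eq_mul, ← Nat.cast_sum]
  congr 2
  simp only [hL, c.blockShift_iterate x ha]
  rfl

lemma V2FCode.sum_delay_blockEnd (ha : ArrivesForever a) (i : ℕ) :
    ∑ n ∈ Finset.range (c.blockEnd x i), delay c r x a (n + 1) =
    ∑ k ∈ Finset.range i, (((c.blockData (c.blockShift^[k] (x, a))).1 : ℝ) * sojourn (c.len / r)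
      (interarrival ∘ fun i => c.blockData (c.blockShift^[i] (x, a))) (k + 1) +
    (c.blockData (c.blockShift^[k] (x, a))).2.2) := by
  induction i with
  | zero => simp [V2FCode.blockEnd]
  | succ i ih =>
    rw [Finset.sum_range_succ, ← ih, ← c.sum_delay_block r x ha, c.blockEnd_succ x ha,
      Finset.sum_range_add]

lemma V2FCode.exists_blockEnd_le_lt (n : ℕ) :
    ∃ i, c.blockEnd x i ≤ n ∧ n < c.blockEnd x (i + 1) := by
  induction n with
  | zero => exact ⟨0, le_rfl, Nat.zero_lt_of_lt (c.strictMono_blockEnd x (Nat.lt_succ_self 0))⟩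
  | succ n ih =>
    obtain ⟨i, h1, h2⟩ := ih
    rcases Nat.lt_or_ge (n + 1) (c.blockEnd x (i + 1)) with h | h
    · exact ⟨i, by omega, h⟩
    · exact ⟨i + 1, h, by have := c.strictMono_blockEnd x (Nat.lt_add_one (i + 1)); omega⟩

lemma V2FCode.delay_nonneg (hr : 0 ≤ r) (ha : ArrivesForever a) (n : ℕ) :
    0 ≤ delay c r x a (n + 1) := by
  obtain ⟨i, h1, h2⟩ := c.exists_blockEnd_le_lt x n
  rw [delay, c.blockOf_eq x (i := i) (by omega) (by omega), c.decodeTime_eq r x ha]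
  have h3 : (arrivalTime a (n + 1) : ℝ) ≤ arrivalTime a (c.blockEnd x (i + 1)) := by
    exact_mod_cast ha.strictMono_arrivalTime.monotone h2
  have h4 : 0 ≤ sojourn (c.len / r)
      (interarrival ∘ fun i => c.blockData (c.blockShift^[i] (x, a))) (i + 1) :=
    sojourn_nonneg (by positivity) _
  linarith

end Deterministic

end Blocks

/-! ### From averages over blocks to averages over symbols -/

section RunningMean

lemma sum_Icc_one_eq_sum_range (u : ℕ → ℝ) (n : ℕ) :
    ∑ k ∈ Finset.Icc 1 n, u k = ∑ k ∈ Finset.range n, u (k + 1) := by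
  induction n with
  | zero => simp
  | succ n ih => rw [Finset.sum_Icc_succ_top (by omega), ih, Finset.sum_range_succ]

lemma runningMean_eq (u : ℕ → ℝ) (n : ℕ) :
    runningMean u n = (∑ k ∈ Finset.range n, u (k + 1)) / n := by
  rw [runningMean, sum_Icc_one_eq_sum_range]

/-- Convergence of `T n / n` for a monotone sequence `T` follows from convergence along a sequence
of indices with a positive density. -/
lemma tendsto_div_of_tendsto_comp_div {T : ℕ → ℝ} (hT : Monotone T) (hT0 : ∀ n, 0 ≤ T n)
    {N : ℕ → ℕ} (hN : StrictMono N) (hcov : ∀ n, ∃ i, N i ≤ n ∧ n < N (i + 1)) {α β : ℝ}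
    (hβ : 0 < β) (h1 : Tendsto (fun i : ℕ => T (N i) / i) atTop (𝓝 α))
    (h2 : Tendsto (fun i : ℕ => (N i : ℝ) / i) atTop (𝓝 β)) :
    Tendsto (fun n : ℕ => T n / n) atTop (𝓝 (α / β)) := by
  choose j hj1 hj2 using hcov
  have hj : Tendsto j atTop atTop := by
    refine tendsto_atTop.2 fun M => ?_
    filter_upwards [eventually_ge_atTop (N M)] with n hn
    by_contra! hlt
    have := hN.monotone (show j n + 1 ≤ M from hlt)
    have := hj2 n
    omega
  have hsucc : Tendsto (fun i : ℕ => (i : ℝ) / ((i + 1 : ℕ) : ℝ)) atTop (𝓝 1) := by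
    have := tendsto_natCast_div_add_atTop (𝕜 := ℝ) 1
    exact this.congr fun n => by push_cast; rfl
  have hsucc' : Tendsto (fun i : ℕ => ((i + 1 : ℕ) : ℝ) / (i : ℝ)) atTop (𝓝 1) := by
    have := hsucc.inv₀ one_ne_zero
    rw [inv_one] at this
    exact this.congr fun n => by rw [inv_div]
  have h1' := h1.comp (tendsto_add_atTop_nat 1)
  have h2' := h2.comp (tendsto_add_atTop_nat 1)
  -- For `N i ≤ n < N (i + 1)`, the quotient `T n / n` lies between `T (N i) / N (i + 1)` and `T (N
  -- (i + 1)) / N i`, and both have the same limit.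
  have hlow : Tendsto (fun i : ℕ => T (N i) / N (i + 1)) atTop (𝓝 (α / β)) := by
    have := (h1.mul hsucc).div h2' hβ.ne'
    rw [mul_one] at this
    refine this.congr' ?_
    filter_upwards [eventually_gt_atTop 0] with i hi
    have hi' : (i : ℝ) ≠ 0 := by positivity
    have hi1 : ((i + 1 : ℕ) : ℝ) ≠ 0 := by positivity
    simp only [Pi.div_apply, Function.comp]
    rw [div_mul_div_cancel₀ hi', div_div_div_cancel_right₀ hi1]
  have hup : Tendsto (fun i : ℕ => T (N (i + 1)) / N i) atTop (𝓝 (α / β)) := by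
    have := (h1'.mul hsucc').div h2 hβ.ne'
    rw [mul_one] at this
    refine this.congr' ?_
    filter_upwards [eventually_gt_atTop 0] with i hi
    have hi' : (i : ℝ) ≠ 0 := by positivity
    have hi1 : ((i + 1 : ℕ) : ℝ) ≠ 0 := by positivity
    simp only [Pi.div_apply, Function.comp]
    rw [div_mul_div_cancel₀ hi1, div_div_div_cancel_right₀ hi']
  refine tendsto_of_tendsto_of_tendsto_of_le_of_le' (hlow.comp hj) (hup.comp hj) ?_ ?_
  · filter_upwards [eventually_gt_atTop 0] with n hn
    have hn' : (0 : ℝ) < n := by exact_mod_cast hn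
    exact div_le_div₀ (hT0 _) (hT (hj1 n)) hn' (by exact_mod_cast (hj2 n).le)
  · filter_upwards [hj.eventually_gt_atTop 0] with n hn
    have hpos : (0 : ℝ) < N (j n) := by
      exact_mod_cast (Nat.zero_le _).trans_lt (hN hn)
    exact div_le_div₀ (hT0 _) (hT (hj2 n).le) hpos (by exact_mod_cast hj1 n)

end RunningMean

/-! ### Mean delay and mean peak age of a fixed code -/

section Limits

lemma ae_arrivesForever_snd {𝒳 : Type*} [MeasurableSpace 𝒳] (νx : Measure 𝒳)
    [IsProbabilityMeasure νx] {νa : Measure Bool} [IsProbabilityMeasure νa] {q : ℝ} (hq : 0 < q)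
    (hνa : νa {true} = ENNReal.ofReal q) :
    ∀ᵐ z ∂((iidLaw νx).prod (iidLaw νa)), ArrivesForever z.2 :=
  Measure.quasiMeasurePreserving_snd.ae (ae_arrivesForever νa (measure_true_ne_zero hq hνa))

lemma V2FCode.one_le_meanLen {𝒳 : Type*} [Fintype 𝒳] [MeasurableSpace 𝒳]
    [MeasurableSingletonClass 𝒳] (c : V2FCode 𝒳) (νx : Measure 𝒳) [IsProbabilityMeasure νx] :
    1 ≤ c.meanLen νx := by
  obtain ⟨M, hM⟩ := c.exists_blockLen_le
  have hi : Integrable (fun x => (c.blockLen x : ℝ)) (iidLaw νx) :=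
    Integrable.of_bound
      ((measurable_from_nat (f := fun n : ℕ => (n : ℝ))).comp
        c.measurable_blockLen).aestronglyMeasurable M (ae_of_all _ fun x => by
      rw [Real.norm_of_nonneg (Nat.cast_nonneg _)]
      exact_mod_cast hM x)
  calc (1 : ℝ) = ∫ _, (1 : ℝ) ∂iidLaw νx := by simp
    _ ≤ _ := integral_mono (integrable_const _) hi fun x => Nat.one_le_cast.2 (c.blockLen_pos x)

variable {𝒳 : Type*} [Fintype 𝒳] [MeasurableSpace 𝒳] [MeasurableSingletonClass 𝒳] (c : V2FCode 𝒳)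
  (νx : Measure 𝒳) [IsProbabilityMeasure νx] {νa : Measure Bool} [IsProbabilityMeasure νa]
  {q : ℝ} (hq : 0 < q) (hνa : νa {true} = ENNReal.ofReal q)

include hq hνa

lemma V2FCode.ae_blockData_of_ae {p : (ℕ → ℕ × ℕ × ℕ) → Prop}
    (h : ∀ᵐ b ∂iidLaw (c.blockLaw νx νa), p b) :
    ∀ᵐ z ∂((iidLaw νx).prod (iidLaw νa)), p fun i => c.blockData (c.blockShift^[i] z) := by
  rw [← c.map_blockData_iterate νx νa (measure_true_ne_zero hq hνa)] at h
  exact ae_of_ae_map c.measurable_blockData_iterate.aemeasurable h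

lemma V2FCode.ae_tendsto_sum_blockData_div {f : ℕ × ℕ × ℕ → ℝ} (hf : Measurable f)
    (hfi : Integrable f (c.blockLaw νx νa)) :
    ∀ᵐ z ∂((iidLaw νx).prod (iidLaw νa)), Tendsto
      (fun n : ℕ => (∑ i ∈ Finset.range n, f (c.blockData (c.blockShift^[i] z))) / n) atTop
      (𝓝 (∫ v, f v ∂c.blockLaw νx νa)) := by
  have hmp := measurePreserving_eval_infinitePi (fun _ : ℕ => c.blockLaw νx νa) 0
  have h := ae_tendsto_sum_shift_div (ν := c.blockLaw νx νa) (f := fun b => f (b 0))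
    (hf.comp (measurable_pi_apply 0)) (hmp.integrable_comp_of_integrable hfi)
  have hint : ∫ b : ℕ → ℕ × ℕ × ℕ, f (b 0) ∂iidLaw (c.blockLaw νx νa) =
      ∫ v, f v ∂c.blockLaw νx νa := by
    conv_rhs => rw [← hmp.map_eq]
    exact (integral_map (measurable_pi_apply 0).aemeasurable hf.aestronglyMeasurable).symm
  rw [hint] at h
  exact c.ae_blockData_of_ae νx hq hνa h

lemma V2FCode.ae_tendsto_blockEnd_div :
    ∀ᵐ z ∂((iidLaw νx).prod (iidLaw νa)), Tendsto
      (fun n : ℕ => (c.blockEnd z.1 n : ℝ) / n) atTop (𝓝 (c.meanLen νx)) := by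
  obtain ⟨M, hM⟩ := c.exists_blockLen_le
  -- Truncation at `M` makes the function bounded on all triples and changes nothing on those that
  -- come from blocks.
  have hf : Measurable fun v : ℕ × ℕ × ℕ => ((min v.1 M : ℕ) : ℝ) :=
    (measurable_from_nat (f := fun n => ((min n M : ℕ) : ℝ))).comp measurable_fst
  have hfi : Integrable (fun v : ℕ × ℕ × ℕ => ((min v.1 M : ℕ) : ℝ)) (c.blockLaw νx νa) :=
    Integrable.of_bound hf.aestronglyMeasurable M (ae_of_all _ fun v => by
      rw [Real.norm_of_nonneg (Nat.cast_nonneg _)]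
      exact_mod_cast min_le_right _ _)
  have hint : ∫ v, ((min v.1 M : ℕ) : ℝ) ∂c.blockLaw νx νa = c.meanLen νx := by
    rw [V2FCode.blockLaw, integral_map c.measurable_blockData.aemeasurable hf.aestronglyMeasurable]
    simp only [V2FCode.blockData, min_eq_left (hM _), V2FCode.meanLen]
    rw [integral_fun_fst (fun x => (c.blockLen x : ℝ))]
    simp
  filter_upwards [c.ae_tendsto_sum_blockData_div νx hq hνa hf hfi,
    ae_arrivesForever_snd νx hq hνa] with z hz hg
  rw [hint] at hz
  refine hz.congr fun n => ?_
  congr 1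
  induction n with
  | zero => simp [V2FCode.blockEnd]
  | succ n ih =>
    rw [Finset.sum_range_succ, ih, c.blockEnd_succ z.1 hg, Nat.cast_add,
      min_eq_left (by rw [V2FCode.blockData]; exact hM _)]

/-- Each of at most `M` symbols waits no longer than the interarrival time of the block. -/
lemma V2FCode.integrable_gatherTime :
    Integrable (fun v : ℕ × ℕ × ℕ => (v.2.2 : ℝ)) (c.blockLaw νx νa) := by
  obtain ⟨M, hM⟩ := c.exists_blockLen_le
  have hm : Measurable fun v : ℕ × ℕ × ℕ => (v.2.2 : ℝ) :=
    (measurable_from_nat (f := fun n : ℕ => (n : ℝ))).comp (measurable_snd.comp measurable_snd)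
  have hi := c.integrable_interarrival νx hq hνa
  rw [V2FCode.blockLaw, integrable_map_measure hm.aestronglyMeasurable
    c.measurable_blockData.aemeasurable]
  rw [V2FCode.blockLaw, integrable_map_measure measurable_interarrival.aestronglyMeasurable
    c.measurable_blockData.aemeasurable] at hi
  refine (hi.const_mul (M : ℝ)).mono (hm.comp c.measurable_blockData).aestronglyMeasurable
    (ae_of_all _ fun z => ?_)
  simp only [Function.comp, interarrival, V2FCode.blockData]
  rw [Real.norm_of_nonneg (Nat.cast_nonneg _), Real.norm_of_nonneg (by positivity)]
  have h1 : gatherTime z.2 (c.blockLen z.1) ≤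
      c.blockLen z.1 * arrivalTime z.2 (c.blockLen z.1) := by
    refine (Finset.sum_le_card_nsmul _ _ _ fun k _ => Nat.sub_le _ _).trans ?_
    simp
  exact_mod_cast h1.trans (Nat.mul_le_mul_right _ (hM z.1))

/-- If blocks arrive more slowly than they are transmitted, then the mean delay exists. -/
theorem V2FCode.exists_ae_tendsto_delay {r : ℝ} (hr : 0 < r)
    (hlt : c.len / r < c.meanLen νx / q) :
    ∃ d : ℝ, ∀ᵐ z ∂((iidLaw νx).prod (iidLaw νa)),
      Tendsto (runningMean (delay c r z.1 z.2)) atTop (𝓝 d) := by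
  obtain ⟨M, hM⟩ := c.exists_blockLen_le
  have hi := c.integrable_interarrival νx hq hνa
  have hs : 0 ≤ c.len / r := by positivity
  have hw : Measurable fun v : ℕ × ℕ × ℕ => ((min v.1 M : ℕ) : ℝ) :=
    (measurable_from_nat (f := fun n => ((min n M : ℕ) : ℝ))).comp measurable_fst
  have hg : Measurable fun v : ℕ × ℕ × ℕ => (v.2.2 : ℝ) :=
    (measurable_from_nat (f := fun n : ℕ => (n : ℝ))).comp (measurable_snd.comp measurable_snd)
  obtain ⟨d, hd⟩ := exists_ae_tendsto_sum_sojourn_div measurable_interarrival interarrival_nonneg hi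
    hs (by rwa [c.integral_interarrival νx hq hνa]) hw (fun v => Nat.cast_nonneg _) (K := M)
    (fun v => by exact_mod_cast min_le_right _ _)
  -- The mean total delay of a block, divided by its mean number of symbols.
  refine ⟨(d + ∫ v, (v.2.2 : ℝ) ∂c.blockLaw νx νa) / c.meanLen νx, ?_⟩
  filter_upwards [c.ae_blockData_of_ae νx hq hνa hd, c.ae_tendsto_blockEnd_div νx hq hνa,
    c.ae_tendsto_sum_blockData_div νx hq hνa hg (c.integrable_gatherTime νx hq hνa),
    ae_arrivesForever_snd νx hq hνa] with z hz1 hz2 hz3 hz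
  have hnn := c.delay_nonneg r z.1 hr.le hz
  have h := tendsto_div_of_tendsto_comp_div
    (T := fun n => ∑ k ∈ Finset.range n, delay c r z.1 z.2 (k + 1))
    (monotone_nat_of_le_succ fun n => by
      rw [Finset.sum_range_succ]
      exact le_add_of_nonneg_right (hnn n))
    (fun n => Finset.sum_nonneg fun k _ => hnn k) (c.strictMono_blockEnd z.1)
    (c.exists_blockEnd_le_lt z.1) (zero_lt_one.trans_le (c.one_le_meanLen νx))
    (α := d + ∫ v, (v.2.2 : ℝ) ∂c.blockLaw νx νa) ?_ hz2
  · exact h.congr fun n => (runningMean_eq _ n).symm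
  · refine (hz1.add hz3).congr fun n => ?_
    rw [c.sum_delay_blockEnd r z.1 hz, ← add_div, ← Finset.sum_add_distrib]
    congr 1
    refine Finset.sum_congr rfl fun k _ => ?_
    rw [min_eq_left (by rw [V2FCode.blockData]; exact hM _)]

/-- If blocks arrive more slowly than they are transmitted, then the mean peak age of information
exists. -/
theorem V2FCode.exists_ae_tendsto_peakAoI {r : ℝ} (hr : 0 < r)
    (hlt : c.len / r < c.meanLen νx / q) :
    ∃ g : ℝ, ∀ᵐ z ∂((iidLaw νx).prod (iidLaw νa)),
      Tendsto (runningMean (peakAoI c r z.1 z.2)) atTop (𝓝 g) := by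
  have hi := c.integrable_interarrival νx hq hνa
  have hs : 0 ≤ c.len / r := by positivity
  obtain ⟨d, hd⟩ := exists_ae_tendsto_sum_sojourn_div measurable_interarrival interarrival_nonneg hi
    hs (by rwa [c.integral_interarrival νx hq hνa]) (w := fun _ => 1) measurable_const
    (fun v => zero_le_one) (K := 1) (fun v => le_rfl)
  refine ⟨∫ v, interarrival v ∂c.blockLaw νx νa + d, ?_⟩
  filter_upwards [c.ae_blockData_of_ae νx hq hνa hd,
    c.ae_tendsto_sum_blockData_div νx hq hνa measurable_interarrival hi,
    ae_arrivesForever_snd νx hq hνa] with z hz1 hz2 hz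
  refine (hz2.add hz1).congr fun n => ?_
  rw [runningMean_eq, ← add_div, ← Finset.sum_add_distrib]
  congr 1
  refine Finset.sum_congr rfl fun k _ => ?_
  rw [c.peakAoI_eq r z.1 hz, one_mul]

/-- If blocks do not arrive more slowly than they are transmitted, then the averages of the sojourn
times of the blocks tend to infinity. -/
lemma V2FCode.ae_tendsto_sojourn_atTop (hq1 : q < 1) {r : ℝ} (hr : 0 < r)
    (hle : c.meanLen νx / q ≤ c.len / r) :
    ∀ᵐ z ∂((iidLaw νx).prod (iidLaw νa)), Tendsto (fun n : ℕ => (∑ i ∈ Finset.range n,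
      sojourn (c.len / r) (interarrival ∘ fun i => c.blockData (c.blockShift^[i] z)) (i + 1)) / n)
      atTop atTop :=
  c.ae_blockData_of_ae νx hq hνa (ae_tendsto_sum_sojourn_div_atTop measurable_interarrival
    interarrival_nonneg (c.integrable_interarrival νx hq hνa) (by positivity)
    (by rwa [c.integral_interarrival νx hq hνa])
    (c.measure_lt_interarrival_ne_zero νx hq hq1 hνa))

/-- If blocks do not arrive more slowly than they are transmitted, then the averages of the delays
are almost surely unbounded. -/
theorem V2FCode.ae_not_bddAbove_delay (hq1 : q < 1) {r : ℝ} (hr : 0 < r)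
    (hle : c.meanLen νx / q ≤ c.len / r) :
    ∀ᵐ z ∂((iidLaw νx).prod (iidLaw νa)),
      ¬ BddAbove (Set.range (runningMean (delay c r z.1 z.2))) := by
  filter_upwards [c.ae_tendsto_sojourn_atTop νx hq hνa hq1 hr hle,
    ae_arrivesForever_snd νx hq hνa, c.ae_tendsto_blockEnd_div νx hq hνa] with z hz hg hN
  rintro ⟨K, hK⟩
  set m := c.meanLen νx with hm
  have hm1 : 1 ≤ m := c.one_le_meanLen νx
  -- The first `n` blocks contain at most `(m + 1) * n` symbols, and every sojourn time is the delay
  -- of at least one symbol up to a nonnegative term. So the average delay at the end of block `n`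
  -- exceeds `K`.
  obtain ⟨n, h1, h2, h3⟩ := ((hz.eventually_gt_atTop (max K 0 * (m + 1))).and
    ((hN.eventually (gt_mem_nhds (lt_add_one m))).and (eventually_gt_atTop 0))).exists
  have hn : (0 : ℝ) < n := by exact_mod_cast h3
  have hpos : (0 : ℝ) < c.blockEnd z.1 n := by
    exact_mod_cast (Nat.zero_le _).trans_lt (c.strictMono_blockEnd z.1 h3)
  have hb : runningMean (delay c r z.1 z.2) (c.blockEnd z.1 n) ≤ K := hK ⟨_, rfl⟩
  rw [runningMean_eq, div_le_iff₀ hpos, c.sum_delay_blockEnd r z.1 hg] at hb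
  rw [lt_div_iff₀ hn] at h1
  rw [div_lt_iff₀ hn] at h2
  have hsum : ∑ i ∈ Finset.range n, sojourn (c.len / r)
      (interarrival ∘ fun i => c.blockData (c.blockShift^[i] z)) (i + 1) ≤
      ∑ k ∈ Finset.range n, (((c.blockData (c.blockShift^[k] (z.1, z.2))).1 : ℝ) *
        sojourn (c.len / r) (interarrival ∘ fun i => c.blockData (c.blockShift^[i] (z.1, z.2)))
          (k + 1) + (c.blockData (c.blockShift^[k] (z.1, z.2))).2.2) := by
    refine Finset.sum_le_sum fun k _ => ?_
    have h4 : 0 ≤ sojourn (c.len / r)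
        (interarrival ∘ fun i => c.blockData (c.blockShift^[i] z)) (k + 1) :=
      sojourn_nonneg (by positivity) _
    have h5 : (1 : ℝ) ≤ (c.blockData (c.blockShift^[k] z)).1 := by
      exact_mod_cast c.blockLen_pos _
    have h6 : (0 : ℝ) ≤ (c.blockData (c.blockShift^[k] z)).2.2 := Nat.cast_nonneg _
    change _ ≤ ((c.blockData (c.blockShift^[k] z)).1 : ℝ) * _ + _
    exact (le_mul_of_one_le_left h4 h5).trans (le_add_of_nonneg_right h6)
  have h7 : K * c.blockEnd z.1 n ≤ max K 0 * ((m + 1) * n) :=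
    (mul_le_mul_of_nonneg_right (le_max_left _ _) hpos.le).trans
      (mul_le_mul_of_nonneg_left h2.le (le_max_right _ _))
  linarith

/-- If blocks do not arrive more slowly than they are transmitted, then the averages of the peak
ages of information are almost surely unbounded. -/
theorem V2FCode.ae_not_bddAbove_peakAoI (hq1 : q < 1) {r : ℝ} (hr : 0 < r)
    (hle : c.meanLen νx / q ≤ c.len / r) :
    ∀ᵐ z ∂((iidLaw νx).prod (iidLaw νa)),
      ¬ BddAbove (Set.range (runningMean (peakAoI c r z.1 z.2))) := by
  filter_upwards [c.ae_tendsto_sojourn_atTop νx hq hνa hq1 hr hle,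
    ae_arrivesForever_snd νx hq hνa] with z hz hg
  rintro ⟨K, hK⟩
  obtain ⟨n, hn⟩ := (hz.eventually_gt_atTop K).exists
  have hb : runningMean (peakAoI c r z.1 z.2) n ≤ K := hK ⟨_, rfl⟩
  refine absurd (hn.trans_le ?_) (not_lt.2 hb)
  rw [runningMean_eq]
  refine div_le_div_of_nonneg_right (Finset.sum_le_sum fun k _ => ?_) n.cast_nonneg
  rw [c.peakAoI_eq r z.1 hg]
  exact le_add_of_nonneg_left (interarrival_nonneg _)

end Limits

/-! ### Probabilities of words -/

section Words

variable {𝒳 : Type*}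

/-- The probability of a word. -/
def wordProb (p : PMF 𝒳) (w : List 𝒳) : ℝ := (w.map fun x => (p x).toReal).prod

/-- The information content, in bits, of a symbol. -/
def information (p : PMF 𝒳) (x : 𝒳) : ℝ := -Real.logb 2 (p x).toReal

variable (p : PMF 𝒳)

lemma toReal_pmf_le_one (x : 𝒳) : (p x).toReal ≤ 1 := by
  rw [← ENNReal.toReal_one]
  exact ENNReal.toReal_mono ENNReal.one_ne_top (p.coe_le_one x)

@[simp]
lemma wordProb_nil : wordProb p [] = 1 := rfl

@[simp]
lemma wordProb_cons (x : 𝒳) (w : List 𝒳) :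
    wordProb p (x :: w) = (p x).toReal * wordProb p w := by
  simp [wordProb]

lemma wordProb_append (u v : List 𝒳) : wordProb p (u ++ v) = wordProb p u * wordProb p v := by
  simp [wordProb]

lemma wordProb_nonneg (w : List 𝒳) : 0 ≤ wordProb p w := by
  induction w with
  | nil => simp
  | cons x w ih => rw [wordProb_cons]; positivity

lemma wordProb_le_one (w : List 𝒳) : wordProb p w ≤ 1 := by
  induction w with
  | nil => simp
  | cons x w ih =>
    rw [wordProb_cons]
    exact mul_le_one₀ (toReal_pmf_le_one p x) (wordProb_nonneg p w) ih

lemma wordProb_anti {u v : List 𝒳} (h : u <+: v) : wordProb p v ≤ wordProb p u := by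
  obtain ⟨w, rfl⟩ := h
  rw [wordProb_append]
  exact mul_le_of_le_one_right (wordProb_nonneg p u) (wordProb_le_one p w)

lemma sum_information_eq {w : List 𝒳} (hw : wordProb p w ≠ 0) :
    (w.map (information p)).sum = -Real.logb 2 (wordProb p w) := by
  induction w with
  | nil => simp
  | cons x w ih =>
    rw [wordProb_cons] at hw ⊢
    rw [List.map_cons, List.sum_cons, ih (right_ne_zero_of_mul hw),
      Real.logb_mul (left_ne_zero_of_mul hw) (right_ne_zero_of_mul hw), information]
    ring

lemma map_range_sum (f : 𝒳 → ℝ) (x : ℕ → 𝒳) (n : ℕ) :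
    (((List.range n).map x).map f).sum = ∑ i ∈ Finset.range n, f (x i) := by
  rw [List.map_map]
  induction n with
  | zero => simp
  | succ n ih => rw [List.range_succ, List.map_append, List.sum_append, ih,
      Finset.sum_range_succ]; simp

variable [Fintype 𝒳] [MeasurableSpace 𝒳] [MeasurableSingletonClass 𝒳]

lemma measure_map_range_eq (u : List 𝒳) :
    (iidLaw p.toMeasure).real {x | (List.range u.length).map x = u} = wordProb p u := by
  induction u with
  | nil => simp
  | cons y u ih =>
    have hset : {x : ℕ → 𝒳 | (List.range (y :: u).length).map x = y :: u} =
        {x | x 0 = y} ∩ shift 1 ⁻¹' {x | (List.range u.length).map x = u} := by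
      ext x
      simp only [List.length_cons, List.range_succ_eq_map, List.map_cons, List.map_map,
        Set.mem_ofPred_eq, List.cons.injEq, Set.mem_inter_iff, Set.mem_preimage]
      have : (x ∘ Nat.succ) = shift 1 x := by
        funext k
        simp [shift, add_comm]
      rw [this]
    have hm : MeasurableSet {x : ℕ → 𝒳 | x 0 = y} :=
      measurableSet_eq_fun (measurable_pi_apply 0) measurable_const
    have h0 : (iidLaw p.toMeasure) {x : ℕ → 𝒳 | x 0 = y} = p y := by
      rw [← p.toMeasure_apply_singleton y (measurableSet_singleton y)]
      exact (measurePreserving_eval_infinitePi (fun _ : ℕ => p.toMeasure) 0).measure_preimage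
        (measurableSet_singleton y).nullMeasurableSet
    have hm' : MeasurableSet {x : ℕ → 𝒳 | (List.range u.length).map x = u} :=
      measurableSet_map_range u.length {u}
    rw [hset, measureReal_def, measure_inter_preimage_shift _ hm
      (fun z z' h hz => by
        rw [Set.mem_ofPred_eq] at hz ⊢
        rw [← hz, h 0 one_pos])
      hm', ENNReal.toReal_mul, h0, wordProb_cons, ← ih]
    rfl

end Words

/-! ### Converse of variable-to-fixed source coding -/

section Converse

variable {𝒳 : Type*} [Fintype 𝒳] [MeasurableSpace 𝒳] [MeasurableSingletonClass 𝒳]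
  (c : V2FCode 𝒳)

/-- Wald's identity for the length of a block. -/
lemma V2FCode.integral_sum_blockLen (ν : Measure 𝒳) [IsProbabilityMeasure ν] (f : 𝒳 → ℝ) :
    ∫ x, ∑ i ∈ Finset.range (c.blockLen x), f (x i) ∂iidLaw ν = c.meanLen ν * ∫ y, f y ∂ν := by
  obtain ⟨M, hM⟩ := c.exists_blockLen_le
  have hC : ∀ i, MeasurableSet {x : ℕ → 𝒳 | i < c.blockLen x} := fun i =>
    measurableSet_lt measurable_const c.measurable_blockLen
  -- Whether the block goes on past `i` symbols depends on these symbols only, hence is independent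
  -- of the next symbol `x i`.
  have hdet : ∀ i, DeterminedBy i {x : ℕ → 𝒳 | i < c.blockLen x} := by
    intro i x x' h hx
    rw [Set.mem_ofPred_eq] at hx ⊢
    by_contra! hle
    have := c.determinedBy_blockLen (c.blockLen x') x' x (fun k hk => (h k (by omega)).symm) rfl
    rw [Set.mem_ofPred_eq] at this
    omega
  have hsplit : ∀ (g : 𝒳 → ℝ) (x : ℕ → 𝒳), ∑ i ∈ Finset.range (c.blockLen x), g (x i) =
      ∑ i ∈ Finset.range M, {x : ℕ → 𝒳 | i < c.blockLen x}.indicator (fun x => g (x i)) x := by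
    intro g x
    rw [← Finset.sum_subset (Finset.range_subset_range.2 (hM x))]
    · refine Finset.sum_congr rfl fun i hi => ?_
      rw [Set.indicator_of_mem (by simpa using hi)]
    · intro i _ hi
      rw [Set.indicator_of_notMem (by simpa using hi)]
  have hfi : ∀ (g : 𝒳 → ℝ) i, Integrable (fun x : ℕ → 𝒳 => g (x i)) (iidLaw ν) := fun g i =>
    (measurePreserving_eval_infinitePi (fun _ : ℕ => ν) i).integrable_comp_of_integrable
      (Integrable.of_finite : Integrable g ν)
  have key : ∀ g : 𝒳 → ℝ, ∫ x, ∑ i ∈ Finset.range (c.blockLen x), g (x i) ∂iidLaw ν =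
      (∑ i ∈ Finset.range M, (iidLaw ν).real {x | i < c.blockLen x}) * ∫ y, g y ∂ν := by
    intro g
    simp only [hsplit]
    rw [integral_finsetSum _ fun i _ => (hfi g i).indicator (hC i), Finset.sum_mul]
    refine Finset.sum_congr rfl fun i _ => ?_
    have hgm : Measurable g := Measurable.of_discrete
    have h1 : ∫ x in {x | i < c.blockLen x}, g (x i) ∂iidLaw ν =
        ∫ x, g (x 0) ∂(((iidLaw ν).restrict {x | i < c.blockLen x}).map (shift i)) := by
      have hg0 : Measurable fun x : ℕ → 𝒳 => g (x 0) := hgm.comp (measurable_pi_apply 0)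
      rw [integral_map (measurable_shift i).aemeasurable hg0.aestronglyMeasurable]
      rfl
    rw [integral_indicator (hC i), h1, map_shift_restrict ν (hC i) (hdet i), integral_smul_measure,
      smul_eq_mul, measureReal_def]
    congr 1
    conv_rhs => rw [← (measurePreserving_eval_infinitePi (fun _ : ℕ => ν) 0).map_eq]
    exact (integral_map (measurable_pi_apply 0).aemeasurable hgm.aestronglyMeasurable).symm
  -- The constant function `1` identifies the sum of the tail probabilities as the mean length.
  have h1 := key fun _ => 1
  simp only [Finset.sum_const, Finset.card_range, nsmul_eq_mul, mul_one, integral_const,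
    probReal_univ, one_smul] at h1
  rw [key f, ← h1, V2FCode.meanLen]

/-- By completeness and prefix-freeness, exactly one word of the dictionary is a prefix of the
stream, so the cylinders of the words partition the space. -/
lemma V2FCode.integral_firstWord (p : PMF 𝒳) (g : List 𝒳 → ℝ) :
    ∫ x, g ((List.range (c.blockLen x)).map x) ∂iidLaw p.toMeasure =
      ∑ u ∈ c.finite_dict.toFinset, wordProb p u * g u := by
  have hm : ∀ u : List 𝒳, MeasurableSet {x : ℕ → 𝒳 | (List.range u.length).map x = u} := fun u =>
    measurableSet_map_range u.length {u}
  have hsplit : ∀ x : ℕ → 𝒳, g ((List.range (c.blockLen x)).map x) =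
      ∑ u ∈ c.finite_dict.toFinset,
        {x : ℕ → 𝒳 | (List.range u.length).map x = u}.indicator (fun _ => g u) x := by
    intro x
    rw [Finset.sum_eq_single ((List.range (c.blockLen x)).map x)]
    · rw [Set.indicator_of_mem (by simp)]
    · intro u hu hne
      rw [Set.indicator_of_notMem]
      intro hx
      rw [Set.mem_ofPred_eq] at hx
      refine hne ?_
      rw [c.blockLen_eq_of_mem (n := u.length) (by rw [hx]; simpa using hu), hx]
    · intro hx
      exact absurd (by simpa using c.blockLen_mem x) hx
  simp only [hsplit]
  rw [integral_finsetSum _ fun u _ => (integrable_const _).indicator (hm u)]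
  refine Finset.sum_congr rfl fun u _ => ?_
  rw [integral_indicator_const _ (hm u), measure_map_range_eq, smul_eq_mul]

/-- Gibbs' inequality against the uniform distribution, from `log t ≤ t - 1` at `t = 1 / (w i *
s.card)`. -/
lemma sum_mul_neg_logb_le {ι : Type*} (s : Finset ι) {w : ι → ℝ} (hw : ∀ i ∈ s, 0 ≤ w i)
    (hsum : ∑ i ∈ s, w i = 1) :
    ∑ i ∈ s, w i * -Real.logb 2 (w i) ≤ Real.logb 2 s.card := by
  have hlog2 : 0 < Real.log 2 := Real.log_pos one_lt_two
  have hcard : (0 : ℝ) < s.card := by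
    rw [Nat.cast_pos, Finset.card_pos]
    by_contra h
    rw [Finset.not_nonempty_iff_eq_empty.1 h] at hsum
    simp at hsum
  have hpt : ∀ i ∈ s, w i * -Real.log (w i) ≤ w i * Real.log s.card + 1 / s.card - w i := by
    intro i hi
    rcases (hw i hi).eq_or_lt with h | h
    · rw [← h]
      simp
    · have h1 := Real.log_le_sub_one_of_pos (show 0 < 1 / (w i * s.card) by positivity)
      rw [one_div, Real.log_inv, Real.log_mul h.ne' hcard.ne'] at h1
      have h2 := mul_le_mul_of_nonneg_left h1 h.le
      have h3 : w i * ((w i * s.card)⁻¹ - 1) = 1 / s.card - w i := by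
        field_simp
      linarith
  have h := Finset.sum_le_sum hpt
  rw [Finset.sum_sub_distrib, Finset.sum_add_distrib, ← Finset.sum_mul, hsum, Finset.sum_const,
    nsmul_eq_mul, mul_one_div_cancel hcard.ne'] at h
  have h4 : ∑ i ∈ s, w i * -Real.logb 2 (w i) = (∑ i ∈ s, w i * -Real.log (w i)) / Real.log 2 := by
    rw [Finset.sum_div]
    refine Finset.sum_congr rfl fun i _ => ?_
    rw [Real.logb]
    ring
  rw [h4, Real.logb]
  exact div_le_div_of_nonneg_right (by linarith) hlog2.le

lemma integral_information (p : PMF 𝒳) : ∫ y, information p y ∂p.toMeasure = entropy p := by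
  rw [PMF.integral_eq_sum]
  simp [information, entropy, smul_eq_mul]

/-- The converse of the source coding theorem for variable-to-fixed codes. -/
theorem V2FCode.entropy_mul_meanLen_le (p : PMF 𝒳) :
    entropy p * c.meanLen p.toMeasure ≤ c.len := by
  -- The mean information of the first word is computed in two ways: by Wald's identity it is the
  -- entropy times the mean length, and summed over the dictionary it is the entropy of the first
  -- word.
  have h1 := c.integral_sum_blockLen p.toMeasure (information p)
  simp only [← map_range_sum] at h1
  rw [c.integral_firstWord p (fun w => (w.map (information p)).sum), integral_information] at h1
  have hsum : ∑ u ∈ c.finite_dict.toFinset, wordProb p u = 1 := by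
    have := c.integral_firstWord p fun _ => 1
    simpa using this.symm
  have h2 : ∑ u ∈ c.finite_dict.toFinset, wordProb p u * (u.map (information p)).sum =
      ∑ u ∈ c.finite_dict.toFinset, wordProb p u * -Real.logb 2 (wordProb p u) := by
    refine Finset.sum_congr rfl fun u _ => ?_
    by_cases hu : wordProb p u = 0
    · rw [hu, zero_mul, zero_mul]
    · rw [sum_information_eq p hu]
  rw [mul_comm, ← h1, h2]
  refine (sum_mul_neg_logb_le _ (fun u _ => wordProb_nonneg p u) hsum).trans ?_
  have hcard : c.finite_dict.toFinset.card ≤ 2 ^ c.len := by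
    rw [← Set.ncard_eq_toFinset_card _ c.finite_dict]
    exact c.ncard_dict_le
  have hpos : 0 < c.finite_dict.toFinset.card := by
    rw [Finset.card_pos]
    by_contra h
    rw [Finset.not_nonempty_iff_eq_empty.1 h] at hsum
    simp at hsum
  rw [Real.logb_le_iff_le_rpow one_lt_two (by exact_mod_cast hpos), Real.rpow_natCast]
  exact_mod_cast hcard

end Converse

/-! ### Achievability by a threshold dictionary -/

section Achievability

variable {𝒳 : Type*} (p : PMF 𝒳)

/-- The words that are cut as soon as their length is `k` or their probability falls below `θ`. -/
def thresholdDict (k : ℕ) (θ : ℝ) : Set (List 𝒳) :=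
  {w | w ≠ [] ∧ w.length ≤ k ∧ θ ≤ wordProb p w.dropLast ∧ (w.length = k ∨ wordProb p w < θ)}

variable {p} {k : ℕ} {θ : ℝ}

/-- A proper prefix of `v` is a prefix of `v.dropLast`, so it is shorter than `k` and has
probability at least `θ`: it would not have been cut. -/
lemma eq_of_prefix_of_mem_thresholdDict {u v : List 𝒳} (hu : u ∈ thresholdDict p k θ)
    (hv : v ∈ thresholdDict p k θ) (h : u <+: v) : u = v := by
  by_contra hne
  have hlt : u.length < v.length :=
    lt_of_le_of_ne h.length_le fun he => hne (h.eq_of_length he)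
  have hpre : u <+: v.dropLast := by
    refine List.prefix_of_prefix_length_le h (List.dropLast_prefix v) ?_
    rw [List.length_dropLast]
    omega
  have := wordProb_anti p hpre
  rcases hu.2.2.2 with h1 | h1
  · have := hv.2.1
    omega
  · linarith [hv.2.2.1]

lemma dropLast_map_range (x : ℕ → 𝒳) (n : ℕ) :
    ((List.range (n + 1)).map x).dropLast = (List.range n).map x := by
  rw [List.range_succ, List.map_append, List.map_singleton, List.dropLast_concat]

lemma exists_map_range_mem_thresholdDict (hk : 0 < k) (hθ : θ ≤ 1) (x : ℕ → 𝒳) :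
    ∃ n, (List.range n).map x ∈ thresholdDict p k θ := by
  classical
  -- The search runs over `n + 1` since words must be nonempty; `θ ≤ 1` settles the case in which
  -- the remaining prefix is empty.
  have hex : ∃ n, n + 1 = k ∨ wordProb p ((List.range (n + 1)).map x) < θ :=
    ⟨k - 1, Or.inl (by omega)⟩
  have hspec := Nat.find_spec hex
  have hmin := fun m (hm : m < Nat.find hex) => Nat.find_min hex hm
  have hle : Nat.find hex ≤ k - 1 := Nat.find_min' hex (Or.inl (by omega))
  refine ⟨Nat.find hex + 1, by simp,
    by rw [List.length_map, List.length_range]; omega, ?_,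
    by rwa [List.length_map, List.length_range]⟩
  rw [dropLast_map_range]
  rcases Nat.eq_zero_or_pos (Nat.find hex) with h | h
  · rw [h]
    simpa using hθ
  · have := hmin (Nat.find hex - 1) (by omega)
    rw [not_or, not_lt, Nat.sub_add_cancel h] at this
    exact this.2

lemma map_range_mem_thresholdDict (hk : 0 < k) {x : ℕ → 𝒳}
    (h : θ ≤ wordProb p ((List.range k).map x)) :
    (List.range k).map x ∈ thresholdDict p k θ := by
  refine ⟨by simp; omega, by simp, ?_, Or.inl (by simp)⟩
  exact h.trans (wordProb_anti p (List.dropLast_prefix _))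

variable [Fintype 𝒳]

lemma card_filter_wordProb_mul_le [DecidableEq 𝒳] (j : ℕ) :
    ((Finset.univ.filter fun w : Fin j → 𝒳 => θ ≤ wordProb p (List.ofFn w)).card : ℝ) * θ ≤ 1 := by
  have hsum : ∑ w : Fin j → 𝒳, wordProb p (List.ofFn w) = 1 := by
    have h1 : ∀ w : Fin j → 𝒳, wordProb p (List.ofFn w) = ∏ i, (p (w i)).toReal := fun w => by
      rw [wordProb, List.map_ofFn, List.prod_ofFn]
      rfl
    have h2 : ∑ y, (p y).toReal = 1 := by
      rw [← ENNReal.toReal_sum fun y _ => p.apply_ne_top y,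
        ← tsum_fintype (L := .unconditional _), p.tsum_coe, ENNReal.toReal_one]
    simp only [h1]
    rw [← Fintype.piFinset_univ, Finset.sum_prod_piFinset Finset.univ fun _ y => (p y).toReal]
    simp [h2]
  calc _ = ∑ w ∈ Finset.univ.filter fun w : Fin j → 𝒳 => θ ≤ wordProb p (List.ofFn w), θ := by
        rw [Finset.sum_const, nsmul_eq_mul]
    _ ≤ ∑ w ∈ Finset.univ.filter fun w : Fin j → 𝒳 => θ ≤ wordProb p (List.ofFn w),
          wordProb p (List.ofFn w) := Finset.sum_le_sum fun w hw => (Finset.mem_filter.1 hw).2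
    _ ≤ ∑ w : Fin j → 𝒳, wordProb p (List.ofFn w) :=
        Finset.sum_le_sum_of_subset_of_nonneg (Finset.filter_subset _ _)
          fun w _ _ => wordProb_nonneg p _
    _ = 1 := hsum

/-- A word of the dictionary is a word of length below `k` and probability at least `θ` followed by
one letter. For each length there are at most `1 / θ` words of such probability. -/
lemma exists_finset_thresholdDict_subset (hθ : 0 < θ) :
    ∃ s : Finset (List 𝒳), thresholdDict p k θ ⊆ s ∧ (s.card : ℝ) * θ ≤ k * Fintype.card 𝒳 := by
  classical
  let G : (j : ℕ) → Finset (Fin j → 𝒳) := fun j =>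
    Finset.univ.filter fun w : Fin j → 𝒳 => θ ≤ wordProb p (List.ofFn w)
  refine ⟨(Finset.range k).biUnion fun j =>
    (G j ×ˢ (Finset.univ : Finset 𝒳)).image fun v => List.ofFn v.1 ++ [v.2], ?_, ?_⟩
  · rintro w ⟨hne, hlen, hgood, -⟩
    simp only [Finset.coe_biUnion, Set.mem_iUnion, Finset.mem_coe, Finset.mem_range,
      Finset.mem_image, Finset.mem_product, Finset.mem_univ, and_true, Prod.exists, exists_prop]
    have hpos := List.length_pos_iff.2 hne
    refine ⟨w.dropLast.length, by rw [List.length_dropLast]; omega, w.dropLast.get,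
      w.getLast hne, ?_, ?_⟩
    · rw [Finset.mem_filter, List.ofFn_get]
      exact ⟨Finset.mem_univ _, hgood⟩
    · rw [List.ofFn_get, List.dropLast_append_getLast]
  · have h1 : (((Finset.range k).biUnion fun j =>
        (G j ×ˢ (Finset.univ : Finset 𝒳)).image fun v => List.ofFn v.1 ++ [v.2]).card : ℝ) ≤
        ∑ j ∈ Finset.range k, ((G j).card : ℝ) * Fintype.card 𝒳 := by
      have h2 := Finset.card_biUnion_le (s := Finset.range k) (t := fun j =>
        (G j ×ˢ (Finset.univ : Finset 𝒳)).image fun v => List.ofFn v.1 ++ [v.2])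
      have h3 : ∀ j ∈ Finset.range k, ((G j ×ˢ (Finset.univ : Finset 𝒳)).image
          fun v => List.ofFn v.1 ++ [v.2]).card ≤ (G j).card * Fintype.card 𝒳 := fun j _ => by
        refine Finset.card_image_le.trans ?_
        rw [Finset.card_product, Finset.card_univ]
      exact_mod_cast h2.trans (Finset.sum_le_sum h3)
    calc _ ≤ (∑ j ∈ Finset.range k, ((G j).card : ℝ) * Fintype.card 𝒳) * θ :=
          mul_le_mul_of_nonneg_right h1 hθ.le
      _ = ∑ j ∈ Finset.range k, ((G j).card : ℝ) * θ * Fintype.card 𝒳 := by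
          rw [Finset.sum_mul]
          exact Finset.sum_congr rfl fun j _ => by ring
      _ ≤ ∑ j ∈ Finset.range k, 1 * (Fintype.card 𝒳 : ℝ) := Finset.sum_le_sum fun j _ =>
          mul_le_mul_of_nonneg_right (card_filter_wordProb_mul_le j) (Nat.cast_nonneg _)
      _ = k * Fintype.card 𝒳 := by simp

variable (p) in
lemma exists_code_of_card_le (hk : 0 < k) (hθ : 0 < θ) (hθ1 : θ ≤ 1) {ℓ : ℕ} (hℓ : 0 < ℓ)
    (hcard : (k * Fintype.card 𝒳 : ℝ) ≤ θ * 2 ^ ℓ) :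
    ∃ c : V2FCode 𝒳, c.len = ℓ ∧
      ∀ x : ℕ → 𝒳, θ ≤ wordProb p ((List.range k).map x) → c.blockLen x = k := by
  classical
  obtain ⟨s, hs, hsc⟩ := exists_finset_thresholdDict_subset (p := p) (k := k) hθ
  have hle : s.card ≤ 2 ^ ℓ := by
    have : (s.card : ℝ) * θ ≤ 2 ^ ℓ * θ := by linarith
    exact_mod_cast le_of_mul_le_mul_right this hθ
  obtain ⟨e⟩ : Nonempty (s ↪ (Fin ℓ → Bool)) :=
    Function.Embedding.nonempty_of_card_le (by simpa using hle)
  let c : V2FCode 𝒳 :=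
    { len := ℓ
      len_pos := hℓ
      dict := thresholdDict p k θ
      nil_notMem := fun h => h.1 rfl
      prefix_free := fun u hu v hv h => eq_of_prefix_of_mem_thresholdDict hu hv h
      complete := exists_map_range_mem_thresholdDict hk hθ1
      enc := fun w => if h : w ∈ s then e ⟨w, h⟩ else fun _ => false
      enc_injOn := fun u hu v hv h => by
        have hu' : u ∈ s := hs hu
        have hv' : v ∈ s := hs hv
        simp only [dif_pos hu', dif_pos hv'] at h
        exact congrArg Subtype.val (e.injective h) }
  exact ⟨c, rfl, fun x hx => c.blockLen_eq_of_mem (map_range_mem_thresholdDict hk hx)⟩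

variable [MeasurableSpace 𝒳] [MeasurableSingletonClass 𝒳]

/-- The asymptotic equipartition property: a block of `k` symbols has probability at least
`2 ^ (-k h)`, for every `h` above the entropy, with a probability that tends to `1`. -/
lemma tendsto_measure_le_wordProb {h : ℝ} (hh : entropy p < h) :
    Tendsto (fun k : ℕ => (iidLaw p.toMeasure).real
      {x | (2 : ℝ) ^ (-(k * h)) ≤ wordProb p ((List.range k).map x)}) atTop (𝓝 1) := by
  have hm : ∀ k : ℕ, MeasurableSet
      {x : ℕ → 𝒳 | (2 : ℝ) ^ (-(k * h)) ≤ wordProb p ((List.range k).map x)} := fun k =>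
    measurableSet_map_range k {w | (2 : ℝ) ^ (-(k * h)) ≤ wordProb p w}
  have hinf : Measurable (information p) := Measurable.of_discrete
  have hmp := fun i => measurePreserving_eval_infinitePi (fun _ : ℕ => p.toMeasure) i
  have hlln := ae_tendsto_sum_shift_div (ν := p.toMeasure) (f := fun x => information p (x 0))
    (hinf.comp (measurable_pi_apply 0))
    ((hmp 0).integrable_comp_of_integrable
      (Integrable.of_finite : Integrable (information p) p.toMeasure))
  have hint : ∫ x : ℕ → 𝒳, information p (x 0) ∂iidLaw p.toMeasure = entropy p := by
    rw [← integral_information p]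
    conv_rhs => rw [← (hmp 0).map_eq]
    exact (integral_map (measurable_pi_apply 0).aemeasurable hinf.aestronglyMeasurable).symm
  rw [hint] at hlln
  -- Since `Real.logb 2 0 = 0`, `information` does not detect symbols of probability zero; these
  -- have to be excluded almost surely.
  have hpos : ∀ᵐ y ∂p.toMeasure, (p y).toReal ≠ 0 := by
    rw [ae_iff]
    have : {y | ¬ (p y).toReal ≠ 0} = {y | p y = 0} := by
      ext y
      simp [ENNReal.toReal_eq_zero_iff, p.apply_ne_top y]
    rw [this, p.toMeasure_apply_eq_zero_iff (Set.toFinite _).measurableSet,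
      Set.disjoint_left]
    exact fun y hy hy' => (p.mem_support_iff y).1 hy hy'
  have hpos' : ∀ᵐ x ∂iidLaw p.toMeasure, ∀ i, (p (x i)).toReal ≠ 0 :=
    ae_all_iff.2 fun i => (hmp i).quasiMeasurePreserving.ae hpos
  have hev : ∀ᵐ x ∂iidLaw p.toMeasure, ∀ᶠ k : ℕ in atTop,
      x ∈ {x : ℕ → 𝒳 | (2 : ℝ) ^ (-(k * h)) ≤ wordProb p ((List.range k).map x)} := by
    filter_upwards [hlln, hpos'] with x hx hx0
    filter_upwards [hx.eventually (gt_mem_nhds hh), eventually_gt_atTop 0] with k hk hk0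
    have hne : wordProb p ((List.range k).map x) ≠ 0 := by
      refine List.prod_ne_zero fun h0 => ?_
      simp only [List.map_map, List.mem_map] at h0
      obtain ⟨i, -, hi⟩ := h0
      exact hx0 i hi
    have hwpos : 0 < wordProb p ((List.range k).map x) :=
      lt_of_le_of_ne (wordProb_nonneg p _) hne.symm
    rw [div_lt_iff₀ (by exact_mod_cast hk0)] at hk
    have hs := sum_information_eq p hne
    rw [map_range_sum] at hs
    have h3 : ∑ i ∈ Finset.range k, information p (shift i x 0) =
        ∑ i ∈ Finset.range k, information p (x i) := rfl
    rw [h3, hs] at hk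
    rw [← Real.le_logb_iff_rpow_le one_lt_two hwpos]
    linarith
  have hlim := tendsto_measure_of_ae_tendsto_indicator atTop (μ := iidLaw p.toMeasure)
    (A := Set.univ) MeasurableSet.univ hm (B := Set.univ) MeasurableSet.univ
    (measure_ne_top _ _) (Eventually.of_forall fun k => Set.subset_univ _) (by
      filter_upwards [hev] with x hx
      filter_upwards [hx] with k hk
      simp [hk])
  have := (ENNReal.tendsto_toReal (measure_ne_top (iidLaw p.toMeasure) Set.univ)).comp hlim
  rw [measure_univ, ENNReal.toReal_one] at this
  exact this

lemma tendsto_logb_mul_div (C : ℝ) (hC : 0 < C) :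
    Tendsto (fun k : ℕ => Real.logb 2 (k * C) / k) atTop (𝓝 0) := by
  have h1 : Tendsto (fun k : ℕ => Real.log k / k) atTop (𝓝 0) :=
    Real.isLittleO_log_id_atTop.tendsto_div_nhds_zero.comp tendsto_natCast_atTop_atTop
  have h2 : Tendsto (fun k : ℕ => Real.log C / k) atTop (𝓝 0) :=
    tendsto_const_nhds.div_atTop tendsto_natCast_atTop_atTop
  have h3 := (h1.add h2).div_const (Real.log 2)
  simp only [add_zero, zero_div] at h3
  refine h3.congr' ?_
  filter_upwards [eventually_gt_atTop 0] with k hk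
  rw [Real.logb, Real.log_mul (by positivity) hC.ne']
  field_simp

variable (p) in
/-- The achievability part of the source coding theorem for variable-to-fixed codes. -/
theorem exists_code_len_lt {R : ℝ} (hR : 0 < R) (hp : entropy p < R) :
    ∃ c : V2FCode 𝒳, c.len < R * c.meanLen p.toMeasure := by
  -- Positivity of `h` ensures that the threshold `2 ^ (-(k * h))` is at most `1` and that the
  -- output length is positive.
  obtain ⟨h, hh1, hh2⟩ := exists_between (max_lt hp hR)
  obtain ⟨hh0, hh⟩ := max_lt_iff.1 hh1
  have hcard : (0 : ℝ) < Fintype.card 𝒳 := by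
    obtain ⟨y, -⟩ := p.support_nonempty
    exact_mod_cast Fintype.card_pos_iff.2 ⟨y⟩
  have hlim1 := (tendsto_measure_le_wordProb hh0).const_mul R
  have hlim2 : Tendsto (fun k : ℕ => h + Real.logb 2 (k * Fintype.card 𝒳) / k + 1 / k) atTop
      (𝓝 (h + 0 + 0)) :=
    ((tendsto_logb_mul_div _ hcard).const_add h).add
      (tendsto_const_nhds.div_atTop tendsto_natCast_atTop_atTop)
  rw [add_zero, add_zero] at hlim2
  rw [mul_one] at hlim1
  -- After multiplication by `k`, the left side is `T + 1`, which exceeds the output length `⌈T⌉₊`;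
  -- the term `1 / k` pays for rounding. The right side becomes `R` times a lower bound for the mean
  -- length, since blocks have full length `k` on `G`.
  obtain ⟨k, hlt, hk⟩ := ((hlim2.eventually_lt hlim1 hh2).and (eventually_gt_atTop 0)).exists
  have hk' : (0 : ℝ) < k := by exact_mod_cast hk
  -- The binary logarithm of the bound `k * Fintype.card 𝒳 / θ` for the size of the dictionary.
  set T : ℝ := k * h + Real.logb 2 (k * Fintype.card 𝒳) with hT
  have hT0 : 0 < T := by
    refine add_pos_of_pos_of_nonneg (by positivity) (Real.logb_nonneg one_lt_two ?_)
    have h1 : (1 : ℝ) ≤ k := by exact_mod_cast hk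
    have h2 : (1 : ℝ) ≤ Fintype.card 𝒳 := by exact_mod_cast hcard
    nlinarith
  obtain ⟨c, hc1, hc2⟩ := exists_code_of_card_le p (θ := (2 : ℝ) ^ (-(k * h))) (ℓ := ⌈T⌉₊) hk
    (by positivity) (Real.rpow_le_one_of_one_le_of_nonpos one_le_two (by nlinarith))
    (Nat.ceil_pos.2 hT0) (by
      rw [← Real.rpow_natCast, ← Real.rpow_add two_pos,
        ← Real.logb_le_iff_le_rpow one_lt_two (by positivity)]
      linarith [Nat.le_ceil T])
  refine ⟨c, ?_⟩
  set G := {x : ℕ → 𝒳 | (2 : ℝ) ^ (-(k * h)) ≤ wordProb p ((List.range k).map x)} with hG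
  have hGm : MeasurableSet G :=
    measurableSet_map_range k {w | (2 : ℝ) ^ (-(k * h)) ≤ wordProb p w}
  obtain ⟨M, hM⟩ := c.exists_blockLen_le
  have hi : Integrable (fun x => (c.blockLen x : ℝ)) (iidLaw p.toMeasure) :=
    Integrable.of_bound
      ((measurable_from_nat (f := fun n : ℕ => (n : ℝ))).comp
        c.measurable_blockLen).aestronglyMeasurable M (ae_of_all _ fun x => by
      rw [Real.norm_of_nonneg (Nat.cast_nonneg _)]
      exact_mod_cast hM x)
  have hmean : (iidLaw p.toMeasure).real G * k ≤ c.meanLen p.toMeasure := by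
    rw [V2FCode.meanLen, ← smul_eq_mul, ← integral_indicator_const (k : ℝ) hGm]
    refine integral_mono ((integrable_const _).indicator hGm) hi fun x => ?_
    by_cases hx : x ∈ G
    · rw [Set.indicator_of_mem hx, hc2 x hx]
    · rw [Set.indicator_of_notMem hx]
      exact Nat.cast_nonneg _
  have h1 : T + 1 < R * (iidLaw p.toMeasure).real G * k := by
    have := mul_lt_mul_of_pos_right hlt hk'
    have h2 : (h + Real.logb 2 (k * Fintype.card 𝒳) / k + 1 / k) * k = T + 1 := by
      rw [hT]
      field_simp
    linarith
  calc (c.len : ℝ) = ⌈T⌉₊ := by rw [hc1]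
    _ < T + 1 := Nat.ceil_lt_add_one hT0.le
    _ < R * ((iidLaw p.toMeasure).real G * k) := by rw [← mul_assoc]; exact h1
    _ ≤ _ := mul_le_mul_of_nonneg_left hmean hR.le

end Achievability

end

end RealTimeCoding

/-! ### The law of the source, and conclusion -/

namespace RealTimeCoding

section Source

variable {𝒳 Ω : Type*} [MeasurableSpace 𝒳] [MeasurableSpace Ω] {μ : Measure Ω} [IsProbabilityMeasure μ] {p : PMF 𝒳} {q : ℝ}
  {X : ℕ → Ω → 𝒳} {A : ℕ → Ω → Bool}

/-- The joint law of the symbols and the arrivals of a source. -/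
lemma IsSource.exists_map_eq (h : IsSource μ p q X A) :
    ∃ (νa : Measure Bool) (_ : IsProbabilityMeasure νa), νa {true} = ENNReal.ofReal q ∧
      Measurable (fun ω => ((fun n => X n ω), fun t => A t ω)) ∧
      μ.map (fun ω => ((fun n => X n ω), fun t => A t ω)) =
        (iidLaw p.toMeasure).prod (iidLaw νa) := by
  have hX : Measurable fun ω n => X n ω := measurable_pi_lambda _ h.measurable_symbol
  have hA : Measurable fun ω t => A t ω := measurable_pi_lambda _ h.measurable_arrival
  have hprob : ∀ t, IsProbabilityMeasure (μ.map (A t)) := fun t =>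
    Measure.isProbabilityMeasure_map (h.measurable_arrival t).aemeasurable
  have htrue : ∀ t, μ.map (A t) {true} = ENNReal.ofReal q := fun t => by
    rw [Measure.map_apply (h.measurable_arrival t) (measurableSet_singleton true)]
    exact h.law_arrival t
  -- A probability measure on `Bool` is determined by its mass at `true`.
  have hlaw : ∀ t, μ.map (A t) = μ.map (A 0) := by
    intro t
    refine Measure.ext_of_singleton fun b => ?_
    cases b with
    | true => rw [htrue, htrue]
    | false =>
      have hc : ({false} : Set Bool) = {true}ᶜ := by ext b; simp
      have := hprob t
      have := hprob 0
      rw [hc, prob_compl_eq_one_sub (measurableSet_singleton true),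
        prob_compl_eq_one_sub (measurableSet_singleton true), htrue, htrue]
  refine ⟨μ.map (A 0), hprob 0, htrue 0, hX.prodMk hA, ?_⟩
  have := hprob 0
  rw [(indepFun_iff_map_prod_eq_prod_map_map hX.aemeasurable hA.aemeasurable).1 h.indep,
    h.indep_symbol.map_fun_eq_infinitePi_map h.measurable_symbol,
    h.indep_arrival.map_fun_eq_infinitePi_map h.measurable_arrival]
  simp only [hlaw, h.law_symbol]

end Source

end RealTimeCoding

theorem mainTheorem1 {𝒳 Ω : Type*} [Fintype 𝒳] [MeasurableSpace 𝒳] [MeasurableSingletonClass 𝒳]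
    [MeasurableSpace Ω] (μ : Measure Ω) [IsProbabilityMeasure μ]
    (p : PMF 𝒳) (q r : ℝ) (hq0 : 0 < q) (hq1 : q < 1) (hr : 0 < r)
    (X : ℕ → Ω → 𝒳) (A : ℕ → Ω → Bool) (hsource : IsSource μ p q X A) :
    ((∃ c : V2FCode 𝒳, (∃ d : ℝ, HasMeanDelay μ X A c r d) ∧ (∃ g : ℝ, HasMeanPeakAoI μ X A c r g))
        ↔ entropy p < r / q) ∧
      ((∃ c : V2FCode 𝒳, BoundedMeanDelay μ X A c r) ↔ entropy p < r / q) ∧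
      ((∃ c : V2FCode 𝒳, BoundedMeanPeakAoI μ X A c r) ↔ entropy p < r / q) := by
  obtain ⟨νa, _, hνa, hmeas, hmap⟩ := hsource.exists_map_eq
  have htransfer : ∀ {P : (ℕ → 𝒳) × (ℕ → Bool) → Prop},
      (∀ᵐ z ∂((iidLaw p.toMeasure).prod (iidLaw νa)), P z) →
      ∀ᵐ ω ∂μ, P ((fun n => X n ω), fun t => A t ω) := fun {P} hP => by
    rw [← hmap] at hP
    exact ae_of_ae_map hmeas.aemeasurable hP
  -- The converse bound gives `entropy p * m ≤ c.len < (r / q) * m` for the mean length `m > 0`. The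
  -- strictness of stability is what rules out `entropy p = r / q`.
  have hstable : ∀ c : V2FCode 𝒳, c.len / r < c.meanLen p.toMeasure / q → entropy p < r / q := by
    intro c hc
    rw [div_lt_div_iff₀ hr hq0] at hc
    have hm : 0 < c.meanLen p.toMeasure := zero_lt_one.trans_le (c.one_le_meanLen _)
    have he := mul_le_mul_of_nonneg_right (c.entropy_mul_meanLen_le p) hq0.le
    rw [lt_div_iff₀ hq0]
    refine lt_of_mul_lt_mul_right ?_ hm.le
    linarith
  have hdelay : (∃ c : V2FCode 𝒳, BoundedMeanDelay μ X A c r) → entropy p < r / q := by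
    rintro ⟨c, hc⟩
    refine hstable c ?_
    by_contra! hle
    -- Instability makes the averages unbounded almost surely, not merely with positive probability,
    -- so it conflicts with almost sure boundedness at some sample point.
    obtain ⟨ω, h1, h2⟩ := (hc.and (htransfer
      (c.ae_not_bddAbove_delay p.toMeasure hq0 hνa hq1 hr hle))).exists
    exact h2 h1
  have hpeak : (∃ c : V2FCode 𝒳, BoundedMeanPeakAoI μ X A c r) → entropy p < r / q := by
    rintro ⟨c, hc⟩
    refine hstable c ?_
    by_contra! hle
    obtain ⟨ω, h1, h2⟩ := (hc.and (htransfer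
      (c.ae_not_bddAbove_peakAoI p.toMeasure hq0 hνa hq1 hr hle))).exists
    exact h2 h1
  have hexists : entropy p < r / q → ∃ c : V2FCode 𝒳,
      (∃ d : ℝ, HasMeanDelay μ X A c r d) ∧ ∃ g : ℝ, HasMeanPeakAoI μ X A c r g := by
    intro hp
    obtain ⟨c, hc⟩ := exists_code_len_lt p (div_pos hr hq0) hp
    have hlt : c.len / r < c.meanLen p.toMeasure / q := by
      rw [div_lt_div_iff₀ hr hq0]
      rw [div_mul_eq_mul_div, lt_div_iff₀ hq0] at hc
      linarith
    obtain ⟨d, hd⟩ := c.exists_ae_tendsto_delay p.toMeasure hq0 hνa hr hlt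
    obtain ⟨g, hg⟩ := c.exists_ae_tendsto_peakAoI p.toMeasure hq0 hνa hr hlt
    exact ⟨c, ⟨d, htransfer hd⟩, ⟨g, htransfer hg⟩⟩
  have hbdd : ∀ c : V2FCode 𝒳, (∃ d : ℝ, HasMeanDelay μ X A c r d) →
      BoundedMeanDelay μ X A c r := by
    rintro c ⟨d, hd⟩
    filter_upwards [hd] with ω hω using hω.bddAbove_range
  refine ⟨⟨?_, hexists⟩, ⟨hdelay, ?_⟩, ⟨hpeak, ?_⟩⟩
  · rintro ⟨c, hd, -⟩
    exact hdelay ⟨c, hbdd c hd⟩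
  · intro hp
    obtain ⟨c, hd, -⟩ := hexists hp
    exact ⟨c, hbdd c hd⟩
  · intro hp
    obtain ⟨c, -, g, hg⟩ := hexists hp
    refine ⟨c, ?_⟩
    filter_upwards [hg] with ω hω using hω.bddAbove_range
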